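/- **Model.** Fix $A,\phi,\sigma,\chi,\rho,\lambda,\delta,\beta>0$, $\alpha,\xi,\eta\ge 0$ and $\varepsilon>0$, $\varepsilon\ne 1$. Put $\mathcal S=(0,\infty)^2$, $\bar\theta=\min\{1,\phi/\sigma\}$, $\omega(K,P)=e^{-\delta P^\xi K^\eta}$ and $$U(C,P)=\frac{C^{1-\varepsilon}}{1-\varepsilon}-\chi\frac{P^{1+\beta}}{1+\beta},\qquad U(0,P)=-\infty\ \text{ if }\varepsilon>1 .$$ On a filtered probability space $(\Omega,\mathcal F,\mathbb F,\mathbb P)$ satisfying the usual conditions let $q$ be an $\mathbb F$-Poisson process with constant intensity $\lambda$. For controls $(C,\theta)$ and $(k,p)\in\mathcal S$ the state $(K,P)$ solves $$dK_t=\big((1-\theta_t)AK_t-C_t\big)dt-\big(1-\omega(K_{t-},P_t)\big)K_{t-}\,dq_t,\qquad dP_t=\big((\phi-\sigma\theta_t)AK_t-\alpha P_t\big)dt,\qquad (K_0,P_0)=(k,p).$$ The pair $(C,\theta)$ is admissible from $(k,p)$, written $(C,\theta)\in\mathcal A(k,p)$, if it is $\mathbb F$-progressively measurable with $C_t\ge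 0$ and $\theta_t\in[0,\bar\theta]$ almost everywhere, the state equations have a pathwise unique strong solution with paths in $\mathcal S$, and $\mathbb E\int_0^\infty e^{-\rho t}|U(C_t,P_t)|\,dt<\infty$. Let $J(k,p;C,\theta)=\mathbb E\int_0^\infty e^{-\rho t}U(C_t,P_t)\,dt$; the value function is $(k,p)\mapsto\sup_{(C,\theta)\in\mathcal A(k,p)}J(k,p;C,\theta)$. For $f\in C^2(\mathcal S)$ and numbers $C,\theta$ let $$(\mathcal L^{C,\theta}f)(K,P)=f_K\big((1-\theta)AK-C\big)+f_P\big((\phi-\sigma\theta)AK-\alpha P\big)+\lambda\big(f(\omega(K,P)K,P)-f(K,P)\big).$$ **Theorem.** Let $v\in C^2(\mathcal S)$ satisfy $|v(K,P)|\le c(1+K^{\gamma}+P^{\gamma'})$ on $\mathcal S$ for some $c>0$, $\gamma,\gamma'\ge0$, and, at every $(K,P)\in\mathcal S$, the HJB equation $$\rho v(K,P)=\sup_{C\ge 0,\ \theta\in[0,\bar\theta]}\big\{U(C,P)+(\mathcal L^{C,\theta}v)(K,P)\big\}.$$ Let $(k,p)\in\mathcal S$ and assume the transversality condition $\lim_{T\to\infty}\mathbb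 E[e^{-\rho T}v(K_T,P_T)]=0$ for every $(C,\theta)\in\mathcal A(k,p)$ with state $(K,P)$. (i) For every $(C,\theta)\in\mathcal A(k,p)$, $v(k,p)\ge J(k,p;C,\theta)$. (ii) Let $(\hat C,\hat\theta):\mathcal S\to[0,\infty)\times[0,1]$ be Borel functions such that for all $(K,P)\in\mathcal S$ $$U(\hat C(K,P),P)+(\mathcal L^{\hat C(K,P),\hat\theta(K,P)}v)(K,P)=\sup_{C\ge 0,\ \theta\in[0,\bar\theta]}\big\{U(C,P)+(\mathcal L^{C,\theta}v)(K,P)\big\}.$$ If the feedback control is admissible from $(k,p)$, that is, there is $(K,P)$ such that $C_t=\hat C(K_t,P_t)$, $\theta_t=\hat\theta(K_t,P_t)$ is in $\mathcal A(k,p)$ with state $(K,P)$, then this control is optimal and $$v(k,p)=J(k,p;\hat C,\hat\theta)=\sup_{(C,\theta)\in\mathcal A(k,p)}J(k,p;C,\theta).$$ -/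

import Mathlib

open MeasureTheory ProbabilityTheory Filter Topology Set
open scoped NNReal

noncomputable section

namespace GrowthEnv

/-- Parameters of the growth--environment model: productivity `A` (output is `A * K`), emission
intensity `phi`, abatement efficiency `sigma`, absorption rate `alpha`, discount rate `rho`,
disaster intensity `lam`, utility parameters `eps`, `beta`, `chi`, damage parameters `delta`,
`xi`, `eta`. -/
structure Params where
  A : ℝ
  phi : ℝ
  sigma : ℝ
  alpha : ℝ
  rho : ℝ
  lam : ℝ
  eps : ℝ
  beta : ℝ
  chi : ℝ
  delta : ℝ
  xi : ℝ
  eta : ℝ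
  A_pos : 0 < A
  phi_pos : 0 < phi
  sigma_pos : 0 < sigma
  alpha_nonneg : 0 ≤ alpha
  rho_pos : 0 < rho
  lam_pos : 0 < lam
  eps_pos : 0 < eps
  eps_ne_one : eps ≠ 1
  beta_pos : 0 < beta
  chi_pos : 0 < chi
  delta_pos : 0 < delta
  xi_nonneg : 0 ≤ xi
  eta_nonneg : 0 ≤ eta

/-- The state space `(0, ∞) × (0, ∞)` of pairs (capital, pollution). -/
def stateSpace : Set (ℝ × ℝ) := Ioi 0 ×ˢ Ioi 0

namespace Params

variable (m : Params)

/-- Surviving share of capital at a disaster. -/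
def survival (K P : ℝ) : ℝ := Real.exp (-(m.delta * P ^ m.xi * K ^ m.eta))

/-- Instantaneous utility of consumption `C` at pollution `P`; for `C = 0` and `1 < eps` the
utility is `-∞`, and this level is excluded by `consumptionSet`. -/
def utility (C P : ℝ) : ℝ :=
  C ^ (1 - m.eps) / (1 - m.eps) - m.chi * (P ^ (1 + m.beta) / (1 + m.beta))

/-- The nonnegative consumption levels of finite utility: `[0, ∞)` if `eps < 1` and `(0, ∞)`
if `eps > 1`. -/
def consumptionSet : Set ℝ := {C | 0 ≤ C ∧ (1 < m.eps → 0 < C)}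

/-- Largest abatement share for which emissions remain nonnegative. -/
def thetaBar : ℝ := min 1 (m.phi / m.sigma)

def driftK (K C θ : ℝ) : ℝ := (1 - θ) * (m.A * K) - C

def driftP (K P θ : ℝ) : ℝ := (m.phi - m.sigma * θ) * (m.A * K) - m.alpha * P

/-- The controlled generator, for constant controls `C`, `θ`. -/
def generator (f : ℝ × ℝ → ℝ) (C θ K P : ℝ) : ℝ :=
  deriv (fun k => f (k, P)) K * m.driftK K C θ
    + deriv (fun p => f (K, p)) P * m.driftP K P θ
    + m.lam * (f (m.survival K P * K, P) - f (K, P))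

/-- The values `U(C, P) + (L^{C, θ} f)(K, P)` over all admissible actions `(C, θ)`. -/
def hamiltonianValues (f : ℝ × ℝ → ℝ) (K P : ℝ) : Set ℝ :=
  {h | ∃ C ∈ m.consumptionSet, ∃ θ ∈ Icc 0 m.thetaBar,
    h = m.utility C P + m.generator f C θ K P}

/-- `f` solves the HJB equation
`rho * f(K, P) = sup_{C, θ} (U(C, P) + (L^{C, θ} f)(K, P))` at every point of the state space. -/
def SolvesHJB (f : ℝ × ℝ → ℝ) : Prop :=
  ∀ K P : ℝ, (K, P) ∈ stateSpace → IsLUB (m.hamiltonianValues f K P) (m.rho * f (K, P))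

end Params

/-- At most polynomial growth on the state space. -/
def PolynomialGrowth (f : ℝ × ℝ → ℝ) : Prop :=
  ∃ c γ δ : ℝ, 0 < c ∧ 0 ≤ γ ∧ 0 ≤ δ ∧
    ∀ K P : ℝ, (K, P) ∈ stateSpace → |f (K, P)| ≤ c * (1 + K ^ γ + P ^ δ)

/-- Right-continuous with left limits. -/
def IsCadlag (f : ℝ≥0 → ℝ) : Prop :=
  ∀ t, ContinuousWithinAt f (Ici t) t ∧ ∃ l, Tendsto f (𝓝[<] t) (𝓝 l)

section Stochastic

variable {Ω : Type*} [mΩ : MeasurableSpace Ω]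

/-- The filtration is right-continuous and contains all null sets of `μ`. -/
structure UsualConditions (μ : Measure Ω) (𝓕 : Filtration ℝ≥0 mΩ) : Prop where
  rightContinuous : 𝓕.IsRightContinuous
  complete : ∀ s : Set Ω, μ s = 0 → MeasurableSet[𝓕 0] s

/-- `q` is a Poisson process of intensity `r` relative to the filtration `𝓕`. The increments are
taken in `ℤ`, so that they are the true differences. -/
structure IsPoissonProcess (μ : Measure Ω) (𝓕 : Filtration ℝ≥0 mΩ) (r : ℝ≥0)
    (q : ℝ≥0 → Ω → ℕ) : Prop where
  adapted : Adapted 𝓕 q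
  cadlag : ∀ᵐ ω ∂μ, IsCadlag (fun t => (q t ω : ℝ))
  zero : ∀ᵐ ω ∂μ, q 0 ω = 0
  indep : ∀ s t : ℝ≥0, s < t →
    Indep (MeasurableSpace.comap (fun ω => (q t ω : ℤ) - (q s ω : ℤ)) inferInstance) (𝓕 s) μ
  law : ∀ s t : ℝ≥0, s < t →
    HasLaw (fun ω => (q t ω : ℤ) - (q s ω : ℤ))
      ((poissonMeasure (r * (t - s))).map (Nat.cast : ℕ → ℤ)) μ

/-- `∫_(0,t] h(s) dq(s)` for a path `q` with finitely many jumps on `(0, t]` which is constant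
between them: the sum of `h(s) * (q(s) - q(s-))` over the jump times. -/
def jumpIntegral (h q : ℝ≥0 → ℝ) (t : ℝ≥0) : ℝ :=
  ∑ᶠ s ∈ Ioc 0 t, h s * (q s - Function.leftLim q s)

/-- `(K, P)` is a strong solution, with initial value `(k, p)` and paths in the state space, of
`dK = ((1 - θ) A K - C) dt - (1 - survival(K-, P)) K- dq`,
`dP = ((phi - sigma θ) A K - alpha P) dt`. -/
structure IsStateProcess (m : Params) (μ : Measure Ω) (𝓕 : Filtration ℝ≥0 mΩ)
    (q : ℝ≥0 → Ω → ℕ) (k p : ℝ) (C θ K P : ℝ≥0 → Ω → ℝ) : Prop where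
  adapted_K : Adapted 𝓕 K
  adapted_P : Adapted 𝓕 P
  cadlag : ∀ᵐ ω ∂μ, IsCadlag (fun t => K t ω) ∧ IsCadlag (fun t => P t ω)
  mem_stateSpace : ∀ᵐ ω ∂μ, ∀ t, (K t ω, P t ω) ∈ stateSpace
  integrable : ∀ᵐ ω ∂μ, ∀ t : ℝ≥0,
    IntervalIntegrable
      (fun s : ℝ => m.driftK (K s.toNNReal ω) (C s.toNNReal ω) (θ s.toNNReal ω)) volume 0 t ∧
    IntervalIntegrable
      (fun s : ℝ => m.driftP (K s.toNNReal ω) (P s.toNNReal ω) (θ s.toNNReal ω)) volume 0 t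
  eq_K : ∀ᵐ ω ∂μ, ∀ t : ℝ≥0,
    K t ω = k
      + (∫ s in (0 : ℝ)..t,
          m.driftK (K s.toNNReal ω) (C s.toNNReal ω) (θ s.toNNReal ω))
      - jumpIntegral
          (fun s => (1 - m.survival (Function.leftLim (fun r => K r ω) s) (P s ω))
            * Function.leftLim (fun r => K r ω) s)
          (fun s => (q s ω : ℝ)) t
  eq_P : ∀ᵐ ω ∂μ, ∀ t : ℝ≥0,
    P t ω = p
      + ∫ s in (0 : ℝ)..t,
          m.driftP (K s.toNNReal ω) (P s.toNNReal ω) (θ s.toNNReal ω)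

/-- `(C, θ)` is an admissible control from `(k, p)`, and `(K, P)` is its state process. -/
structure IsAdmissible (m : Params) (μ : Measure Ω) (𝓕 : Filtration ℝ≥0 mΩ)
    (q : ℝ≥0 → Ω → ℕ) (k p : ℝ) (C θ K P : ℝ≥0 → Ω → ℝ) : Prop where
  progressive_C : IsStronglyProgressive 𝓕 C
  progressive_θ : IsStronglyProgressive 𝓕 θ
  mem_actions : ∀ᵐ ω ∂μ, ∀ᵐ t ∂(volume.restrict (Ioi (0 : ℝ))),
    C t.toNNReal ω ∈ m.consumptionSet ∧ θ t.toNNReal ω ∈ Icc 0 m.thetaBar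
  isState : IsStateProcess m μ 𝓕 q k p C θ K P
  unique : ∀ K' P' : ℝ≥0 → Ω → ℝ, IsStateProcess m μ 𝓕 q k p C θ K' P' →
    ∀ᵐ ω ∂μ, ∀ t, K' t ω = K t ω ∧ P' t ω = P t ω
  integrable_utility :
    Integrable (fun x : Ω × ℝ =>
        Real.exp (-m.rho * x.2) * m.utility (C x.2.toNNReal x.1) (P x.2.toNNReal x.1))
      (μ.prod (volume.restrict (Ioi (0 : ℝ))))

/-- The expected discounted utility of a control with consumption `C` and pollution path `P`. -/
def gain (m : Params) (μ : Measure Ω) (C P : ℝ≥0 → Ω → ℝ) : ℝ :=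
  ∫ ω, (∫ t in Ioi (0 : ℝ),
    Real.exp (-m.rho * t) * m.utility (C t.toNNReal ω) (P t.toNNReal ω)) ∂μ

/-- The gains of all admissible controls from `(k, p)`; the value function at `(k, p)` is the
supremum of this set. -/
def gains (m : Params) (μ : Measure Ω) (𝓕 : Filtration ℝ≥0 mΩ)
    (q : ℝ≥0 → Ω → ℕ) (k p : ℝ) : Set ℝ :=
  {J | ∃ C θ K P : ℝ≥0 → Ω → ℝ, IsAdmissible m μ 𝓕 q k p C θ K P ∧ J = gain m μ C P}

/-- `lim_{T → ∞} E[e^{-rho T} f(K_T, P_T)] = 0` for every admissible control from `(k, p)`. -/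
def Transversality (m : Params) (μ : Measure Ω) (𝓕 : Filtration ℝ≥0 mΩ)
    (q : ℝ≥0 → Ω → ℕ) (k p : ℝ) (f : ℝ × ℝ → ℝ) : Prop :=
  ∀ C θ K P : ℝ≥0 → Ω → ℝ, IsAdmissible m μ 𝓕 q k p C θ K P →
    Tendsto (fun T : ℝ≥0 => ∫ ω, Real.exp (-m.rho * T) * f (K T ω, P T ω) ∂μ) atTop (𝓝 0)

/-- The Borel feedback maps `Chat`, `thetahat` attain, at every point of the state space, the
supremum in the HJB equation. -/
structure IsMaximizingFeedback (m : Params) (f Chat thetahat : ℝ × ℝ → ℝ) : Prop where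
  measurable_C : Measurable Chat
  measurable_θ : Measurable thetahat
  mem_C : ∀ x ∈ stateSpace, Chat x ∈ m.consumptionSet
  mem_θ : ∀ x ∈ stateSpace, thetahat x ∈ Icc (0 : ℝ) 1
  attains : ∀ K P : ℝ, (K, P) ∈ stateSpace →
    IsLUB (m.hamiltonianValues f K P)
      (m.utility (Chat (K, P)) P + m.generator f (Chat (K, P)) (thetahat (K, P)) K P)

end Stochastic

end GrowthEnv

end

open GrowthEnv

open GrowthEnv

namespace GrowthEnv

/-! The theorem is a verification argument resting on Dynkin's formula. For an admissible control,
Itô's formula for `e^{-ρt} v(K_t, P_t)` on `[0, T]` produces the drift `e^{-ρt} (L v - ρ v)` and a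
compensated jump integral of mean zero. After adding the running utility, the discounted terminal
value plus utility equals `v(k, p)`, plus a mean zero variable, plus the integral of `e^{-ρt} (U + L
v - ρ v)` (`IsAdmissible.dynkin`). The HJB equation makes this last integrand nonpositive, and zero
under a maximizing feedback. As `T → ∞`, transversality removes the terminal value and integrability
of utility turns the running gain into `J`.

Both stochastic ingredients are elementary here. Almost surely `q` increases by unit jumps, finitely
many on each bounded interval (`ae_isCountingPath`). Between jumps the state is absolutely
continuous and the ordinary chain rule applies (`chainRule_absolutelyContinuous`); at a jump `v`
changes by `jumpSize`. Induction over the jump times glues these pieces into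
`IsStatePath.ito_formula`.

The mean zero property (`integral_compensated_jumpIntegral`) holds for Riemann sums over a grid
because Poisson increments are independent of the past, and passes to the limit by dominated
convergence. No localization is needed: disasters only lower capital, so Grönwall's inequality
bounds the state by constants on `[0, T]`, and polynomial growth then bounds `v` and its jumps. -/

/-- Induction over intervals cut at the points of a locally finite set `S`. -/
theorem interval_induction_of_finite {α : Type*} [LinearOrder α] (S : Set α)
    (hS : ∀ a b, (S ∩ Ioo a b).Finite) (p : α → α → Prop)
    (base : ∀ a b, a < b → S ∩ Ioo a b = ∅ → p a b)
    (trans : ∀ a b c, a < b → b < c → p a b → p b c → p a c) {a b : α} (hab : a < b) : p a b := by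
  induction hn : (S ∩ Ioo a b).ncard using Nat.strong_induction_on generalizing a b with
  | _ n ih =>
    rcases (S ∩ Ioo a b).eq_empty_or_nonempty with h | ⟨c, hcS, hac, hcb⟩
    · exact base a b hab h
    -- A cut at `c ∈ S` leaves `c` outside both open halves, so each half contains fewer points of
    -- `S`.
    · have key : ∀ a' b', a ≤ a' → b' ≤ b → c ∉ Ioo a' b' → (S ∩ Ioo a' b').ncard < n := by
        intro a' b' ha hb hc
        rw [← hn]
        refine Set.ncard_lt_ncard ⟨?_, ?_⟩ (hS a b)
        · exact inter_subset_inter_right _ (Ioo_subset_Ioo ha hb)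
        · exact fun h => hc (h ⟨hcS, hac, hcb⟩).2
      exact trans a c b hac hcb (ih _ (key a c le_rfl hcb.le (by simp)) hac rfl)
        (ih _ (key c b hac.le le_rfl (by simp)) hcb rfl)

/-! ### Counting paths and their jump integrals -/

/-- Right-continuous nondecreasing paths in `ℕ` whose jumps have size at most one. -/
structure IsCountingPath (q : ℝ≥0 → ℕ) : Prop where
  mono : Monotone q
  rightCont : ∀ t, ContinuousWithinAt (fun s => (q s : ℝ)) (Ici t) t
  unit : ∀ s, (q s : ℝ) - Function.leftLim (fun s => (q s : ℝ)) s ≤ 1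

/-- The jump times of a path. -/
def jumpTimes (q : ℝ≥0 → ℕ) : Set ℝ≥0 :=
  {s | Function.leftLim (fun s => (q s : ℝ)) s ≠ q s}

theorem nhdsLT_neBot {s : ℝ≥0} (hs : 0 < s) : (𝓝[<] s).NeBot :=
  nhdsLT_neBot_of_exists_lt ⟨0, hs⟩

namespace IsCountingPath

variable {q : ℝ≥0 → ℕ}

theorem mono_cast (hq : IsCountingPath q) : Monotone (fun s => (q s : ℝ)) :=
  fun _ _ h => Nat.cast_le.2 (hq.mono h)

/-- At the least time `0` the function `leftLim` returns the value itself, so no jump is recorded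
there. -/
theorem pos_of_mem_jumpTimes {s : ℝ≥0} (hs : s ∈ jumpTimes q) : 0 < s := by
  rcases eq_or_ne s 0 with rfl | h
  · exact absurd (leftLim_eq_of_isBot (fun x => zero_le)) hs
  · exact pos_iff_ne_zero.2 h

/-- The values taken before `s` form a bounded set of naturals, so their supremum is attained at
some `r` and the path is constant on `[r, s)`. -/
theorem exists_leftLim_eq (hq : IsCountingPath q) {s : ℝ≥0} (hs : 0 < s) :
    ∃ r < s, Function.leftLim (fun s => (q s : ℝ)) s = q r := by
  have hne : (q '' Iio s).Nonempty := ⟨q 0, 0, hs, rfl⟩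
  have hbdd : BddAbove (q '' Iio s) := ⟨q s, by rintro _ ⟨t, ht, rfl⟩; exact hq.mono (le_of_lt ht)⟩
  obtain ⟨r, hr, hrq⟩ := Nat.sSup_mem hne hbdd
  refine ⟨r, hr, ?_⟩
  have := nhdsLT_neBot hs
  refine leftLim_eq_of_tendsto (tendsto_const_nhds.congr' ?_)
  filter_upwards [Ioo_mem_nhdsLT hr] with t ht
  have h1 : q r ≤ q t := hq.mono ht.1.le
  have h2 : q t ≤ q r := by rw [hrq]; exact le_csSup hbdd ⟨t, ht.2, rfl⟩
  rw [le_antisymm h1 h2]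

theorem jump_eq_one (hq : IsCountingPath q) {s : ℝ≥0} (hs : s ∈ jumpTimes q) :
    (q s : ℝ) - Function.leftLim (fun s => (q s : ℝ)) s = 1 := by
  obtain ⟨r, hr, h⟩ := hq.exists_leftLim_eq (pos_of_mem_jumpTimes hs)
  have h1 := hq.unit s
  have h2 : Function.leftLim (fun s => (q s : ℝ)) s ≠ q s := hs
  rw [h] at h1 h2 ⊢
  have h3 : q r ≤ q s := hq.mono hr.le
  have h4 : q r ≠ q s := fun e => h2 (by rw [e])
  have h5 : ((q r + 1 : ℕ) : ℝ) ≤ q s := Nat.cast_le.2 (by omega)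
  push_cast at h5
  linarith

/-- The path increases strictly from one jump time to the next, so it injects the jump times up to
`T` into the naturals up to `q T`. -/
theorem finite_jumpTimes (hq : IsCountingPath q) (T : ℝ≥0) : (jumpTimes q ∩ Iic T).Finite := by
  refine Set.Finite.of_finite_image (f := q) ((finite_Iic (q T)).subset ?_) ?_
  · rintro _ ⟨s, hs, rfl⟩
    exact hq.mono hs.2
  · have key : ∀ s s', s' ∈ jumpTimes q → s < s' → q s < q s' := by
      intro s s' hs' h
      have h1 := hq.mono_cast.le_leftLim h
      have h2 := hq.mono_cast.leftLim_le (le_refl s')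
      exact_mod_cast lt_of_le_of_lt h1 (lt_of_le_of_ne h2 hs')
    intro s hs s' hs' h
    by_contra hne
    rcases lt_or_gt_of_ne hne with h' | h'
    · exact absurd h (key _ _ hs'.1 h').ne
    · exact absurd h (key _ _ hs.1 h').ne'

theorem finite_jumpTimes_Ioo (hq : IsCountingPath q) (a b : ℝ≥0) :
    (jumpTimes q ∩ Ioo a b).Finite :=
  (hq.finite_jumpTimes b).subset (inter_subset_inter_right _ fun _ h => h.2.le)

theorem exists_lt_no_jump (hq : IsCountingPath q) {b : ℝ≥0} (hb : 0 < b) :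
    ∃ a < b, jumpTimes q ∩ Ioo a b = ∅ := by
  have hfin := hq.finite_jumpTimes_Ioo 0 b
  have hcl : IsClosed (jumpTimes q ∩ Ioo 0 b) := hfin.isClosed
  have hnot : b ∈ (jumpTimes q ∩ Ioo 0 b)ᶜ := fun h => lt_irrefl _ h.2.2
  have hmem := hcl.isOpen_compl.mem_nhds hnot
  obtain ⟨a, ha, hsub⟩ := exists_Ioc_subset_of_mem_nhds hmem ⟨0, hb⟩
  refine ⟨a, ha, ?_⟩
  ext s
  simp only [mem_inter_iff, mem_Ioo, mem_empty_iff_false, iff_false]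
  rintro ⟨hs, h1, h2⟩
  exact hsub ⟨h1, h2.le⟩ ⟨hs, pos_of_mem_jumpTimes hs, h2⟩

/-- Otherwise consider the infimum of the times at which the path exceeds `q a`. By right-continuity
the path already exceeds `q a` there, while before it does not, so the infimum is a jump time inside
`(a, b)`. -/
theorem eq_of_no_jump (hq : IsCountingPath q) {a b t : ℝ≥0}
    (hJ : jumpTimes q ∩ Ioo a b = ∅) (hat : a ≤ t) (htb : t < b) : q t = q a := by
  by_contra hne
  have hlt : q a < q t := lt_of_le_of_ne (hq.mono hat) (Ne.symm hne)
  set A : Set ℝ≥0 := {s | q a < q s} with hA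
  have hAne : A.Nonempty := ⟨t, hlt⟩
  have hAbdd : BddBelow A := OrderBot.bddBelow A
  set s0 := sInf A with hs0
  have hs0t : s0 ≤ t := csInf_le hAbdd hlt
  have hq0 : q a < q s0 := by
    by_contra hcon
    have h1 := (hq.rightCont s0).eventually (Iio_mem_nhds (show ((q s0 : ℕ) : ℝ) < q s0 + 1 by simp))
    have hs0t' : s0 < t := lt_of_le_of_ne hs0t (fun h => hcon (h ▸ hlt))
    obtain ⟨u, hu, hsub⟩ := (mem_nhdsGE_iff_exists_Ico_subset' hs0t').1 h1
    have : u ≤ s0 := by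
      refine le_csInf hAne fun x hx => ?_
      by_contra hxu
      have hx0 : s0 ≤ x := csInf_le hAbdd hx
      have h2 : (q x : ℝ) < q s0 + 1 := hsub ⟨hx0, not_le.1 hxu⟩
      have h3 : q x < q s0 + 1 := by exact_mod_cast h2
      have h4 : q a < q x := hx
      omega
    exact absurd hu (not_lt.2 this)
  have has0 : a < s0 := by
    by_contra h
    exact absurd (hq.mono (not_lt.1 h)) (not_le.2 hq0)
  have hmem : s0 ∈ jumpTimes q := by
    obtain ⟨r, hr, hrl⟩ := hq.exists_leftLim_eq (lt_of_le_of_lt zero_le has0)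
    have hrA : r ∉ A := fun h => absurd (csInf_le hAbdd h) (not_le.2 hr)
    have h1 : q r ≤ q a := not_lt.1 hrA
    intro h
    rw [hrl] at h
    have : q r = q s0 := by exact_mod_cast h
    omega
  have : s0 ∈ jumpTimes q ∩ Ioo a b := ⟨hmem, has0, lt_of_le_of_lt hs0t htb⟩
  rw [hJ] at this
  exact this

theorem support_jump_subset (hq : IsCountingPath q) (h : ℝ≥0 → ℝ) (a b : ℝ≥0) :
    (Ioc a b ∩ Function.support fun s =>
      h s * ((q s : ℝ) - Function.leftLim (fun r => (q r : ℝ)) s)).Finite := by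
  refine (hq.finite_jumpTimes b).subset ?_
  rintro s ⟨hs, hne⟩
  refine ⟨fun e => hne ?_, hs.2⟩
  simp [e]

theorem jumpIntegral_sub (hq : IsCountingPath q) (h : ℝ≥0 → ℝ) {a b : ℝ≥0} (hab : a ≤ b) :
    jumpIntegral h (fun s => (q s : ℝ)) b - jumpIntegral h (fun s => (q s : ℝ)) a =
      ∑ᶠ s ∈ Ioc a b, h s * ((q s : ℝ) - Function.leftLim (fun r => (q r : ℝ)) s) := by
  unfold jumpIntegral
  rw [← Ioc_union_Ioc_eq_Ioc (zero_le (a := a)) hab,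
    finsum_mem_union' (Ioc_disjoint_Ioc_of_le le_rfl) (hq.support_jump_subset h 0 a)
      (hq.support_jump_subset h a b)]
  ring

/-- On a half-open cell `(a, b]` whose interior is free of jumps, only the right end can contribute.
This is the base case of the inductions over jump times. -/
theorem jumpIntegral_sub_of_no_jump (hq : IsCountingPath q) (h : ℝ≥0 → ℝ) {a b : ℝ≥0}
    (hab : a < b) (hJ : jumpTimes q ∩ Ioo a b = ∅) :
    jumpIntegral h (fun s => (q s : ℝ)) b - jumpIntegral h (fun s => (q s : ℝ)) a =
      h b * ((q b : ℝ) - Function.leftLim (fun r => (q r : ℝ)) b) := by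
  rw [hq.jumpIntegral_sub h hab.le]
  have : ∀ s ∈ Ioc a b, s ∉ ({b} : Set ℝ≥0) →
      h s * ((q s : ℝ) - Function.leftLim (fun r => (q r : ℝ)) s) = 0 := by
    intro s hs hsb
    have : s ∉ jumpTimes q := by
      intro hsJ
      have : s ∈ jumpTimes q ∩ Ioo a b := ⟨hsJ, hs.1, lt_of_le_of_ne hs.2 hsb⟩
      rw [hJ] at this
      exact this
    have : Function.leftLim (fun s => (q s : ℝ)) s = q s := not_not.1 this
    simp [this]
  rw [← finsum_mem_singleton (f := fun s =>
    h s * ((q s : ℝ) - Function.leftLim (fun r => (q r : ℝ)) s)) (a := b)]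
  refine finsum_mem_inter_support_eq' _ _ _ fun s hs => ⟨fun hsI => ?_, ?_⟩
  · by_contra hsb
    exact hs (this s hsI hsb)
  · rintro rfl
    exact ⟨hab, le_rfl⟩

theorem jumpIntegral_zero (h q : ℝ≥0 → ℝ) : jumpIntegral h q 0 = 0 := by
  simp [jumpIntegral]

theorem jumpIntegral_mono (hq : IsCountingPath q) {h : ℝ≥0 → ℝ} (h0 : ∀ s, 0 < s → 0 ≤ h s) :
    Monotone (jumpIntegral h (fun s => (q s : ℝ))) := by
  intro a b hab
  rw [← sub_nonneg, hq.jumpIntegral_sub h hab]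
  refine finsum_nonneg fun s => finsum_nonneg fun hs => mul_nonneg (h0 s ?_) ?_
  · exact lt_of_le_of_lt zero_le hs.1
  · exact sub_nonneg.2 (hq.mono_cast.leftLim_le le_rfl)

/-- The jump integral is the sum of the integrand over the finitely many jump times. -/
theorem jumpIntegral_eq_sum (hq : IsCountingPath q) (h : ℝ≥0 → ℝ) (T : ℝ≥0) :
    jumpIntegral h (fun s => (q s : ℝ)) T = ∑ s ∈ (hq.finite_jumpTimes T).toFinset, h s := by
  classical
  unfold jumpIntegral
  rw [finsum_mem_eq_sum_of_inter_support_eq (t := (hq.finite_jumpTimes T).toFinset)]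
  · refine Finset.sum_congr rfl fun s hs => ?_
    rw [hq.jump_eq_one ((Set.Finite.mem_toFinset _).1 hs).1, mul_one]
  · ext s
    simp only [mem_inter_iff, mem_Ioc, Function.mem_support, Finite.coe_toFinset, mem_Iic]
    constructor
    · rintro ⟨⟨-, h2⟩, hne⟩
      exact ⟨⟨fun e => hne (by simp [e]), h2⟩, hne⟩
    · rintro ⟨⟨hJ, h2⟩, hne⟩
      exact ⟨⟨pos_of_mem_jumpTimes hJ, h2⟩, hne⟩

theorem sub_eq_jumpIntegral (hq : IsCountingPath q) {a b : ℝ≥0} (hab : a ≤ b) :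
    (q b : ℝ) - q a = jumpIntegral (fun _ => 1) (fun s => (q s : ℝ)) b
      - jumpIntegral (fun _ => 1) (fun s => (q s : ℝ)) a := by
  rcases hab.eq_or_lt with rfl | hab
  · simp
  refine interval_induction_of_finite (jumpTimes q) hq.finite_jumpTimes_Ioo
    (fun a b => (q b : ℝ) - q a = jumpIntegral (fun _ => 1) (fun s => (q s : ℝ)) b
      - jumpIntegral (fun _ => 1) (fun s => (q s : ℝ)) a) ?_ ?_ hab
  · intro a b hab hJ
    rw [hq.jumpIntegral_sub_of_no_jump _ hab hJ, one_mul]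
    have := nhdsLT_neBot (lt_of_le_of_lt zero_le hab)
    congr 1
    symm
    refine leftLim_eq_of_tendsto (tendsto_const_nhds.congr' ?_)
    filter_upwards [Ioo_mem_nhdsLT hab] with t ht
    rw [hq.eq_of_no_jump hJ ht.1.le ht.2]
  · intro a b c _ _ h1 h2
    linarith

/-- The index set depends on `T` only and not on the cell, so a sum over grid cells can be exchanged
with the sum over jumps. -/
theorem sub_eq_sum_indicator (hq : IsCountingPath q) {a b T : ℝ≥0} (hab : a ≤ b) (hbT : b ≤ T) :
    (q b : ℝ) - q a =
      ∑ s ∈ (hq.finite_jumpTimes T).toFinset, (Ioc a b).indicator (fun _ => (1 : ℝ)) s := by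
  classical
  rw [hq.sub_eq_jumpIntegral hab, hq.jumpIntegral_sub _ hab,
    finsum_mem_eq_sum_of_inter_support_eq
      (t := (hq.finite_jumpTimes T).toFinset.filter (· ∈ Ioc a b)), Finset.sum_filter]
  · refine Finset.sum_congr rfl fun s hs => ?_
    rw [hq.jump_eq_one ((Set.Finite.mem_toFinset _).1 hs).1, mul_one, indicator_apply]
  · ext s
    simp only [mem_inter_iff, mem_Ioc, Function.mem_support, Finset.coe_filter,
      Set.Finite.mem_toFinset, mem_Iic, mem_ofPred_eq]
    constructor
    · rintro ⟨⟨h1, h2⟩, hne⟩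
      exact ⟨⟨⟨fun e => hne (by simp [e]), h2.trans hbT⟩, h1, h2⟩, hne⟩
    · rintro ⟨⟨-, h⟩, hne⟩
      exact ⟨h, hne⟩

end IsCountingPath

/-! ### Chain rule along absolutely continuous paths -/

theorem isOpen_stateSpace : IsOpen stateSpace := isOpen_Ioi.prod isOpen_Ioi

theorem _root_.LipschitzOnWith.comp_prod_absolutelyContinuousOnInterval {w : ℝ × ℝ → ℝ}
    {L : ℝ≥0} {s : Set (ℝ × ℝ)} (hw : LipschitzOnWith L w s) {x y : ℝ → ℝ} {a b : ℝ}
    (hx : AbsolutelyContinuousOnInterval x a b) (hy : AbsolutelyContinuousOnInterval y a b)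
    (hs : ∀ t ∈ uIcc a b, (x t, y t) ∈ s) :
    AbsolutelyContinuousOnInterval (fun t => w (x t, y t)) a b := by
  unfold AbsolutelyContinuousOnInterval at *
  have hlim := (hx.add hy).const_mul (L : ℝ)
  rw [add_zero, mul_zero] at hlim
  refine squeeze_zero' (Eventually.of_forall fun E => Finset.sum_nonneg fun i _ => dist_nonneg)
    ?_ hlim
  -- The principal part of the filter places the endpoints of the small intervals in `uIcc a b`,
  -- where the Lipschitz bound is available.
  filter_upwards [mem_inf_of_right (mem_principal_self _)] with E hE
  rw [← Finset.sum_add_distrib, Finset.mul_sum]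
  refine Finset.sum_le_sum fun i hi => ?_
  obtain ⟨h1, h2⟩ := hE.1 i hi
  refine (hw.dist_le_mul _ (hs _ h1) _ (hs _ h2)).trans ?_
  refine mul_le_mul_of_nonneg_left ?_ L.2
  rw [Prod.dist_eq]
  exact max_le_add_of_nonneg dist_nonneg dist_nonneg

/-- A primitive of an interval integrable function is absolutely continuous, also after adding
a constant. -/
theorem _root_.IntervalIntegrable.absolutelyContinuousOnInterval_const_add {f : ℝ → ℝ} {a b : ℝ}
    (hf : IntervalIntegrable f volume a b) (c : ℝ) :
    AbsolutelyContinuousOnInterval (fun t => c + ∫ s in a..t, f s) a b := by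
  have h1 := hf.absolutelyContinuousOnInterval_intervalIntegral (c := a) (by simp)
  have h2 : AbsolutelyContinuousOnInterval (fun _ : ℝ => c) a b :=
    (contDiffOn_const (n := 1)).absolutelyContinuousOnInterval
  exact h2.add h1

/-- Links the Fréchet derivative, which the chain rule needs, to the partial derivatives that define
`generator`. -/
theorem hasFDerivAt_partial {v : ℝ × ℝ → ℝ} (hv : ContDiffOn ℝ 2 v stateSpace) {z : ℝ × ℝ}
    (hz : z ∈ stateSpace) (r : ℝ × ℝ) :
    HasFDerivAt v (fderiv ℝ v z) z ∧ fderiv ℝ v z r =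
      deriv (fun k => v (k, z.2)) z.1 * r.1 + deriv (fun p => v (z.1, p)) z.2 * r.2 := by
  have hd : HasFDerivAt v (fderiv ℝ v z) z :=
    ((hv.differentiableOn (by norm_num)).differentiableAt
      (isOpen_stateSpace.mem_nhds hz)).hasFDerivAt
  refine ⟨hd, ?_⟩
  have h1 : HasDerivAt (fun k => v (k, z.2)) (fderiv ℝ v z (1, 0)) z.1 :=
    HasFDerivAt.comp_hasDerivAt z.1 (f := fun k => (k, z.2)) (l := v) hd
      ((hasDerivAt_id z.1).prodMk (hasDerivAt_const z.1 z.2))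
  have h2 : HasDerivAt (fun p => v (z.1, p)) (fderiv ℝ v z (0, 1)) z.2 :=
    HasFDerivAt.comp_hasDerivAt z.2 (f := fun p => (z.1, p)) (l := v) hd
      ((hasDerivAt_const z.2 z.1).prodMk (hasDerivAt_id z.2))
  rw [h1.deriv, h2.deriv]
  have : r = r.1 • ((1 : ℝ), (0 : ℝ)) + r.2 • ((0 : ℝ), (1 : ℝ)) := by
    ext <;> simp
  conv_lhs => rw [this]
  rw [map_add, map_smul, map_smul, smul_eq_mul, smul_eq_mul]
  ring

/-- The discounted chain rule integrand. -/
noncomputable def chainIntegrand (ρ : ℝ) (v : ℝ × ℝ → ℝ) (x y f g : ℝ → ℝ) (t : ℝ) : ℝ :=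
  Real.exp (-ρ * t) * (deriv (fun k => v (k, y t)) (x t) * f t
    + deriv (fun p => v (x t, p)) (y t) * g t - ρ * v (x t, y t))

/-- Chain rule along absolutely continuous paths in the state space. -/
theorem chainRule_absolutelyContinuous {v : ℝ × ℝ → ℝ} (hv : ContDiffOn ℝ 2 v stateSpace)
    (ρ : ℝ) {f g : ℝ → ℝ} {a b : ℝ} (hab : a ≤ b) (hf : IntervalIntegrable f volume a b)
    (hg : IntervalIntegrable g volume a b) {x y : ℝ → ℝ}
    (hx : ∀ t, x t = x a + ∫ s in a..t, f s) (hy : ∀ t, y t = y a + ∫ s in a..t, g s)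
    (hmem : ∀ t ∈ Icc a b, (x t, y t) ∈ stateSpace) :
    IntervalIntegrable (chainIntegrand ρ v x y f g) volume a b ∧
    ∫ t in a..b, chainIntegrand ρ v x y f g t =
      Real.exp (-ρ * b) * v (x b, y b) - Real.exp (-ρ * a) * v (x a, y a) := by
  have hxeq : x = fun t => x a + ∫ s in a..t, f s := funext hx
  have hyeq : y = fun t => y a + ∫ s in a..t, g s := funext hy
  have hxac : AbsolutelyContinuousOnInterval x a b := by
    rw [hxeq]; exact hf.absolutelyContinuousOnInterval_const_add _
  have hyac : AbsolutelyContinuousOnInterval y a b := by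
    rw [hyeq]; exact hg.absolutelyContinuousOnInterval_const_add _
  have huI : uIcc a b = Icc a b := uIcc_of_le hab
  have hxc := hxac.continuousOn
  have hyc := hyac.continuousOn
  rw [huI] at hxc hyc
  have hne : (Icc a b).Nonempty := nonempty_Icc.2 hab
  obtain ⟨t1, ht1, hmin1⟩ := isCompact_Icc.exists_isMinOn hne hxc
  obtain ⟨t2, ht2, hmax1⟩ := isCompact_Icc.exists_isMaxOn hne hxc
  obtain ⟨t3, ht3, hmin2⟩ := isCompact_Icc.exists_isMinOn hne hyc
  obtain ⟨t4, ht4, hmax2⟩ := isCompact_Icc.exists_isMaxOn hne hyc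
  -- The extremal coordinates of the path span a compact convex rectangle inside the state space.
  -- There `v` is Lipschitz, so `v` along the path is absolutely continuous and is the integral of
  -- its derivative.
  set B : Set (ℝ × ℝ) := Icc (x t1) (x t2) ×ˢ Icc (y t3) (y t4) with hB
  have hBsub : B ⊆ stateSpace := fun z hz =>
    ⟨lt_of_lt_of_le (hmem t1 ht1).1 hz.1.1, lt_of_lt_of_le (hmem t3 ht3).2 hz.2.1⟩
  obtain ⟨L, hL⟩ := (hv.mono hBsub).exists_lipschitzOnWith (by norm_num)
    ((convex_Icc _ _).prod (convex_Icc _ _)) (isCompact_Icc.prod isCompact_Icc)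
  have hvac : AbsolutelyContinuousOnInterval (fun t => v (x t, y t)) a b :=
    hL.comp_prod_absolutelyContinuousOnInterval hxac hyac fun t ht => by
      rw [huI] at ht
      exact ⟨⟨hmin1 ht, hmax1 ht⟩, ⟨hmin2 ht, hmax2 ht⟩⟩
  have heac : AbsolutelyContinuousOnInterval (fun t => Real.exp (-ρ * t)) a b :=
    ContDiffOn.absolutelyContinuousOnInterval (by fun_prop)
  have hF := heac.fun_mul hvac
  have hderiv : ∀ᵐ t, t ∈ uIcc a b →
      deriv (fun t => Real.exp (-ρ * t) * v (x t, y t)) t = chainIntegrand ρ v x y f g t := by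
    filter_upwards [hf.ae_hasDerivAt_integral, hg.ae_hasDerivAt_integral] with t h1 h2 ht
    have hx' : HasDerivAt x (f t) t := by
      rw [hxeq]; exact (h1 ht a (by simp)).const_add _
    have hy' : HasDerivAt y (g t) t := by
      rw [hyeq]; exact (h2 ht a (by simp)).const_add _
    rw [huI] at ht
    obtain ⟨hd, hp⟩ := hasFDerivAt_partial hv (hmem t ht) (f t, g t)
    have hv' : HasDerivAt (fun t => v (x t, y t)) (fderiv ℝ v (x t, y t) (f t, g t)) t :=
      HasFDerivAt.comp_hasDerivAt t (f := fun t => (x t, y t)) (l := v) hd (hx'.prodMk hy')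
    have he' : HasDerivAt (fun t => Real.exp (-ρ * t)) (Real.exp (-ρ * t) * (-ρ)) t := by
      simpa using ((hasDerivAt_id t).const_mul (-ρ)).exp
    rw [(he'.fun_mul hv').deriv, hp, chainIntegrand]
    ring
  have hderiv' : ∀ᵐ t, t ∈ uIoc a b →
      deriv (fun t => Real.exp (-ρ * t) * v (x t, y t)) t = chainIntegrand ρ v x y f g t := by
    filter_upwards [hderiv] with t ht hmem using ht (uIoc_subset_uIcc hmem)
  refine ⟨hF.intervalIntegrable_deriv.congr_ae ?_, ?_⟩
  · exact (ae_restrict_iff' measurableSet_uIoc).2 hderiv'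
  · rw [← hF.integral_deriv_eq_sub]
    refine intervalIntegral.integral_congr_ae ?_
    filter_upwards [hderiv'] with t ht hmem using (ht hmem).symm

/-! ### State paths: behaviour at jumps, Itô's formula, a priori bounds -/

/-- A path of the state process, with arbitrary integrable drifts `f` and `g`. -/
structure IsStatePath (m : Params) (q : ℝ≥0 → ℕ) (k p : ℝ) (f g : ℝ → ℝ) (K P : ℝ≥0 → ℝ) :
    Prop where
  counting : IsCountingPath q
  cadlag_K : IsCadlag K
  mem_stateSpace : ∀ t, (K t, P t) ∈ stateSpace
  integrable_f : ∀ t : ℝ≥0, IntervalIntegrable f volume 0 t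
  integrable_g : ∀ t : ℝ≥0, IntervalIntegrable g volume 0 t
  eq_K : ∀ t : ℝ≥0, K t = k + (∫ s in (0 : ℝ)..t, f s)
    - jumpIntegral (fun s => (1 - m.survival (Function.leftLim K s) (P s)) * Function.leftLim K s)
        (fun s => (q s : ℝ)) t
  eq_P : ∀ t : ℝ≥0, P t = p + ∫ s in (0 : ℝ)..t, g s

theorem Params.survival_pos (m : Params) (K P : ℝ) : 0 < m.survival K P := Real.exp_pos _

theorem Params.survival_le_one (m : Params) {K P : ℝ} (hK : 0 ≤ K) (hP : 0 ≤ P) :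
    m.survival K P ≤ 1 := by
  have := m.delta_pos.le
  exact Real.exp_le_one_iff.2 (neg_nonpos.2 (by positivity))

/-- The change of `v` caused by a disaster. -/
noncomputable def Params.jumpSize (m : Params) (v : ℝ × ℝ → ℝ) (z : ℝ × ℝ) : ℝ :=
  v (m.survival z.1 z.2 * z.1, z.2) - v z

namespace IsStatePath

variable {m : Params} {q : ℝ≥0 → ℕ} {k p : ℝ} {f g : ℝ → ℝ} {K P : ℝ≥0 → ℝ}

theorem intervalIntegrable_f (h : IsStatePath m q k p f g K P) (a b : ℝ≥0) :
    IntervalIntegrable f volume a b := (h.integrable_f a).symm.trans (h.integrable_f b)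

theorem intervalIntegrable_g (h : IsStatePath m q k p f g K P) (a b : ℝ≥0) :
    IntervalIntegrable g volume a b := (h.integrable_g a).symm.trans (h.integrable_g b)

theorem P_eq_add (h : IsStatePath m q k p f g K P) (a t : ℝ≥0) :
    P t = P a + ∫ s in (a : ℝ)..t, g s := by
  rw [h.eq_P t, h.eq_P a, ← intervalIntegral.integral_add_adjacent_intervals (h.integrable_g a)
    (h.intervalIntegrable_g a t)]
  ring

theorem K_eq_of_no_jump (h : IsStatePath m q k p f g K P) {a b t : ℝ≥0}
    (hJ : jumpTimes q ∩ Ioo a b = ∅) (hat : a ≤ t) (htb : t < b) :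
    K t = K a + ∫ s in (a : ℝ)..t, f s := by
  rcases hat.eq_or_lt with rfl | hat
  · simp
  have hJ' : jumpTimes q ∩ Ioo a t = ∅ :=
    subset_eq_empty (inter_subset_inter_right _ (Ioo_subset_Ioo le_rfl htb.le)) hJ
  have htJ : t ∉ jumpTimes q := fun ht => by
    have : t ∈ jumpTimes q ∩ Ioo a b := ⟨ht, hat, htb⟩
    rw [hJ] at this
    exact this
  have h0 : Function.leftLim (fun s => (q s : ℝ)) t = q t := not_not.1 htJ
  have h1 := h.counting.jumpIntegral_sub_of_no_jump
    (fun s => (1 - m.survival (Function.leftLim K s) (P s)) * Function.leftLim K s) hat hJ'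
  rw [h0, sub_self, mul_zero] at h1
  rw [h.eq_K t, h.eq_K a, ← intervalIntegral.integral_add_adjacent_intervals (h.integrable_f a)
    (h.intervalIntegrable_f a t)]
  linarith

theorem tendsto_leftLim (h : IsStatePath m q k p f g K P) (t : ℝ≥0) :
    Tendsto K (𝓝[<] t) (𝓝 (Function.leftLim K t)) :=
  tendsto_leftLim_of_tendsto (h.cadlag_K t).2

theorem leftLim_K_eq (h : IsStatePath m q k p f g K P) {a b : ℝ≥0} (hab : a < b)
    (hJ : jumpTimes q ∩ Ioo a b = ∅) :
    Function.leftLim K b = K a + ∫ s in (a : ℝ)..b, f s := by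
  have := nhdsLT_neBot (lt_of_le_of_lt zero_le hab)
  refine leftLim_eq_of_tendsto ?_
  have hcont : ContinuousOn (fun t : ℝ => ∫ s in (a : ℝ)..t, f s) (uIcc a b) :=
    intervalIntegral.continuousOn_primitive_interval' (h.intervalIntegrable_f a b) left_mem_uIcc
  have hcoe : Tendsto (fun t : ℝ≥0 => (t : ℝ)) (𝓝[<] b) (𝓝[uIcc (a : ℝ) b] (b : ℝ)) := by
    refine tendsto_nhdsWithin_iff.2
      ⟨(NNReal.continuous_coe.tendsto b).mono_left nhdsWithin_le_nhds, ?_⟩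
    filter_upwards [Ioo_mem_nhdsLT hab] with t ht
    rw [uIcc_of_le (NNReal.coe_le_coe.2 hab.le)]
    exact ⟨NNReal.coe_le_coe.2 ht.1.le, NNReal.coe_le_coe.2 ht.2.le⟩
  refine (((hcont b right_mem_uIcc).tendsto.comp hcoe).const_add (K a)).congr' ?_
  filter_upwards [Ioo_mem_nhdsLT hab] with t ht
  exact (h.K_eq_of_no_jump hJ ht.1.le ht.2).symm

theorem K_eq_leftLim_sub (h : IsStatePath m q k p f g K P) {b : ℝ≥0} (hb : 0 < b) :
    K b = Function.leftLim K b
      - (1 - m.survival (Function.leftLim K b) (P b)) * Function.leftLim K b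
        * ((q b : ℝ) - Function.leftLim (fun r => (q r : ℝ)) b) := by
  obtain ⟨a, hab, hJ⟩ := h.counting.exists_lt_no_jump hb
  have h1 := h.counting.jumpIntegral_sub_of_no_jump
    (fun s => (1 - m.survival (Function.leftLim K s) (P s)) * Function.leftLim K s) hab hJ
  have h2 := h.leftLim_K_eq hab hJ
  have h3 := h.eq_K b
  rw [← intervalIntegral.integral_add_adjacent_intervals (h.integrable_f a)
    (h.intervalIntegrable_f a b)] at h3
  have h4 := h.eq_K a
  linarith

/-- Positivity of the path gives only a nonnegative left limit; if that limit were zero, the jump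
equation would force `K b = 0`. -/
theorem leftLim_K_pos (h : IsStatePath m q k p f g K P) {b : ℝ≥0} (hb : 0 < b) :
    0 < Function.leftLim K b := by
  have := nhdsLT_neBot hb
  have h0 : 0 ≤ Function.leftLim K b :=
    ge_of_tendsto' (h.tendsto_leftLim b) fun t => (h.mem_stateSpace t).1.le
  refine lt_of_le_of_ne h0 fun h1 => ?_
  have h2 := h.K_eq_leftLim_sub hb
  rw [← h1] at h2
  have h3 : 0 < K b := (h.mem_stateSpace b).1
  rw [h2] at h3
  simp at h3

theorem leftLim_K_eq_self (h : IsStatePath m q k p f g K P) {b : ℝ≥0} (hb : 0 < b)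
    (hJ : b ∉ jumpTimes q) : Function.leftLim K b = K b := by
  have h0 : Function.leftLim (fun s => (q s : ℝ)) b = q b := not_not.1 hJ
  have h1 := h.K_eq_leftLim_sub hb
  rw [h0] at h1
  linarith

theorem K_eq_survival_mul (h : IsStatePath m q k p f g K P) {b : ℝ≥0} (hJ : b ∈ jumpTimes q) :
    K b = m.survival (Function.leftLim K b) (P b) * Function.leftLim K b := by
  have h1 := h.K_eq_leftLim_sub (IsCountingPath.pos_of_mem_jumpTimes hJ)
  rw [h.counting.jump_eq_one hJ] at h1
  linarith

/-- Itô's formula for the discounted process `e^{-ρ t} v(K_t, P_t)`. -/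
theorem ito_formula (h : IsStatePath m q k p f g K P) {v : ℝ × ℝ → ℝ}
    (hv : ContDiffOn ℝ 2 v stateSpace) (ρ : ℝ) {a b : ℝ≥0} (hab : a < b) :
    IntervalIntegrable
      (chainIntegrand ρ v (fun t => K t.toNNReal) (fun t => P t.toNNReal) f g) volume a b ∧
    Real.exp (-ρ * b) * v (K b, P b) - Real.exp (-ρ * a) * v (K a, P a) =
      (∫ t in (a : ℝ)..b,
        chainIntegrand ρ v (fun t => K t.toNNReal) (fun t => P t.toNNReal) f g t)
      + (jumpIntegral (fun s => Real.exp (-ρ * s) * m.jumpSize v (Function.leftLim K s, P s))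
          (fun s => (q s : ℝ)) b
        - jumpIntegral (fun s => Real.exp (-ρ * s) * m.jumpSize v (Function.leftLim K s, P s))
          (fun s => (q s : ℝ)) a) := by
  set G := fun s : ℝ≥0 => Real.exp (-ρ * s) * m.jumpSize v (Function.leftLim K s, P s) with hG
  set Φ := chainIntegrand ρ v (fun t => K t.toNNReal) (fun t => P t.toNNReal) f g with hΦ
  refine interval_induction_of_finite (jumpTimes q) h.counting.finite_jumpTimes_Ioo
    (fun a b : ℝ≥0 => IntervalIntegrable Φ volume a b ∧
      Real.exp (-ρ * b) * v (K b, P b) - Real.exp (-ρ * a) * v (K a, P a) =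
      (∫ t in (a : ℝ)..b, Φ t) + (jumpIntegral G (fun s => (q s : ℝ)) b
        - jumpIntegral G (fun s => (q s : ℝ)) a)) ?_ ?_ hab
  · intro a b hab hJ
    have hb : 0 < b := lt_of_le_of_lt zero_le hab
    have hab' : (a : ℝ) < b := NNReal.coe_lt_coe.2 hab
    have hnn : ∀ t : ℝ, (a : ℝ) ≤ t → (t.toNNReal : ℝ) = t := fun t ht =>
      Real.coe_toNNReal t (a.2.trans ht)
    -- The continuous continuation of capital through the cell: it agrees with `K` on `[a, b)` and
    -- ends at the left limit `K_{b-}`. The chain rule is applied to it; the exceptional point `b`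
    -- is null for the integral, and the step from `K_{b-}` to `K_b` is the jump term.
    set x : ℝ → ℝ := fun t => K a + ∫ s in (a : ℝ)..t, f s with hx
    set y : ℝ → ℝ := fun t => P a + ∫ s in (a : ℝ)..t, g s with hy
    have hxK : ∀ t : ℝ, (a : ℝ) ≤ t → t < b → x t = K t.toNNReal := by
      intro t h1 h2
      have h1' : a ≤ t.toNNReal := by rw [← NNReal.coe_le_coe, hnn t h1]; exact h1
      have h2' : t.toNNReal < b := by rw [← NNReal.coe_lt_coe, hnn t h1]; exact h2
      rw [h.K_eq_of_no_jump hJ h1' h2', hnn t h1]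
    have hyP : ∀ t : ℝ, (a : ℝ) ≤ t → y t = P t.toNNReal := by
      intro t h1
      rw [h.P_eq_add a t.toNNReal, hnn t h1]
    have hxb : x b = Function.leftLim K b := (h.leftLim_K_eq hab hJ).symm
    have hyb : y b = P b := by rw [hyP b hab'.le, Real.toNNReal_coe]
    have hmem : ∀ t ∈ Icc (a : ℝ) b, (x t, y t) ∈ stateSpace := by
      intro t ht
      rcases ht.2.eq_or_lt with rfl | htb
      · rw [hxb, hyb]
        exact ⟨h.leftLim_K_pos hb, (h.mem_stateSpace b).2⟩
      · rw [hxK t ht.1 htb, hyP t ht.1]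
        exact h.mem_stateSpace _
    obtain ⟨hint, heq⟩ := chainRule_absolutelyContinuous hv ρ hab'.le (h.intervalIntegrable_f a b)
      (h.intervalIntegrable_g a b) (x := x) (y := y) (fun t => by simp [hx])
      (fun t => by simp [hy]) hmem
    have hΦeq : ∀ t ∈ uIoc (a : ℝ) b, t ≠ b → chainIntegrand ρ v x y f g t = Φ t := by
      intro t ht htb
      rw [uIoc_of_le hab'.le] at ht
      simp only [hΦ, chainIntegrand, hxK t ht.1.le (lt_of_le_of_ne ht.2 htb), hyP t ht.1.le]
    have hΦae : ∀ᵐ t, t ∈ uIoc (a : ℝ) b → chainIntegrand ρ v x y f g t = Φ t := by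
      have : ∀ᵐ t : ℝ, t ≠ b := by simp [ae_iff, measure_singleton]
      filter_upwards [this] with t ht hmem using hΦeq t hmem ht
    refine ⟨hint.congr_ae ((ae_restrict_iff' measurableSet_uIoc).2 hΦae), ?_⟩
    rw [← intervalIntegral.integral_congr_ae hΦae, heq,
      h.counting.jumpIntegral_sub_of_no_jump G hab hJ, hxb, hyb]
    have hxa : x a = K a := by simp [hx]
    have hya : y a = P a := by simp [hy]
    rw [hxa, hya]
    by_cases hbJ : b ∈ jumpTimes q
    · rw [h.counting.jump_eq_one hbJ, hG, h.K_eq_survival_mul hbJ]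
      simp only [Params.jumpSize]
      ring
    · have h0 : Function.leftLim (fun s => (q s : ℝ)) b = q b := not_not.1 hbJ
      rw [h0, h.leftLim_K_eq_self hb hbJ]
      ring
  · rintro a b c - - ⟨h1, h2⟩ ⟨h3, h4⟩
    refine ⟨h1.trans h3, ?_⟩
    rw [← intervalIntegral.integral_add_adjacent_intervals h1 h3]
    linarith

theorem leftLim_nonneg (h : IsStatePath m q k p f g K P) (b : ℝ≥0) (hb : 0 < b) :
    0 ≤ (1 - m.survival (Function.leftLim K b) (P b)) * Function.leftLim K b :=
  mul_nonneg (sub_nonneg.2 (m.survival_le_one (h.leftLim_K_pos hb).le (h.mem_stateSpace b).2.le))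
    (h.leftLim_K_pos hb).le

theorem jumpIntegral_nonneg (h : IsStatePath m q k p f g K P) (t : ℝ≥0) :
    0 ≤ jumpIntegral
      (fun s => (1 - m.survival (Function.leftLim K s) (P s)) * Function.leftLim K s)
      (fun s => (q s : ℝ)) t := by
  have := h.counting.jumpIntegral_mono h.leftLim_nonneg (zero_le (a := t))
  rwa [IsCountingPath.jumpIntegral_zero] at this

/-- Capital is a continuous function minus a nondecreasing one, the accumulated disaster losses. -/
theorem intervalIntegrable_K (h : IsStatePath m q k p f g K P) (T : ℝ≥0) :
    IntervalIntegrable (fun t : ℝ => K t.toNNReal) volume 0 T := by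
  have h1 : IntervalIntegrable (fun t : ℝ => k + ∫ s in (0 : ℝ)..t, f s) volume 0 T :=
    (continuousOn_const.add (intervalIntegral.continuousOn_primitive_interval'
      (h.integrable_f T) left_mem_uIcc)).intervalIntegrable
  have h2 : IntervalIntegrable (fun t : ℝ => jumpIntegral
      (fun s => (1 - m.survival (Function.leftLim K s) (P s)) * Function.leftLim K s)
      (fun s => (q s : ℝ)) t.toNNReal) volume 0 T :=
    ((h.counting.jumpIntegral_mono h.leftLim_nonneg).comp
      fun _ _ hab => Real.toNNReal_mono hab).monotoneOn _ |>.intervalIntegrable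
  refine (h1.sub h2).congr fun t ht => ?_
  rw [uIoc_of_le (show (0 : ℝ) ≤ T from T.2)] at ht
  have := h.eq_K t.toNNReal
  rw [Real.coe_toNNReal t ht.1.le] at this
  exact this.symm

theorem K_le (h : IsStatePath m q k p f g K P) (hk : 0 < k)
    (hf : ∀ᵐ t ∂(volume.restrict (Ioi (0 : ℝ))), f t ≤ m.A * K t.toNNReal) (T : ℝ≥0) :
    K T ≤ k * Real.exp (m.A * T) := by
  -- Grönwall's inequality needs a continuous function, whereas `K` jumps. `Ψ` dominates `K` because
  -- the losses are nonnegative, and right-continuity of `K` gives its right derivative `A K ≤ A Ψ`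
  -- at every time.
  set Ψ : ℝ → ℝ := fun t => k + ∫ s in (0 : ℝ)..t, m.A * K s.toNNReal with hΨ
  have hT0 : (0 : ℝ) ≤ T := T.2
  have hint : ∀ t : ℝ≥0, IntervalIntegrable (fun s : ℝ => m.A * K s.toNNReal) volume 0 t :=
    fun t => (h.intervalIntegrable_K t).const_mul _
  have hKΨ : ∀ t : ℝ≥0, K t ≤ Ψ t := by
    intro t
    rw [h.eq_K t, hΨ]
    have h1 : ∫ s in (0 : ℝ)..t, f s ≤ ∫ s in (0 : ℝ)..t, m.A * K s.toNNReal := by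
      refine intervalIntegral.integral_mono_ae_restrict t.2 (h.integrable_f t) (hint t) ?_
      rw [← restrict_Ioc_eq_restrict_Icc]
      exact ae_restrict_of_ae_restrict_of_subset Ioc_subset_Ioi_self hf
    have h2 := h.jumpIntegral_nonneg t
    simp only
    linarith
  have hcont : ContinuousOn Ψ (Icc 0 T) := by
    have := intervalIntegral.continuousOn_primitive_interval' (hint T) left_mem_uIcc
    rw [uIcc_of_le hT0] at this
    exact continuousOn_const.add this
  have hder : ∀ t ∈ Ico (0 : ℝ) T, HasDerivWithinAt Ψ (m.A * K t.toNNReal) (Ici t) t := by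
    intro t ht
    refine HasDerivWithinAt.const_add _ ?_
    have hi : IntervalIntegrable (fun s : ℝ => m.A * K s.toNNReal) volume 0 t := by
      have := hint t.toNNReal
      rwa [Real.coe_toNNReal t ht.1] at this
    refine intervalIntegral.integral_hasDerivWithinAt_right hi (t := Ioi t) ?_ ?_
    · refine ⟨Ioc t T, Ioc_mem_nhdsGT ht.2, ?_⟩
      exact (((intervalIntegrable_iff_integrableOn_Ioc_of_le hT0).1 (hint T)).mono_set
        (Ioc_subset_Ioc_left ht.1)).aestronglyMeasurable
    · refine continuousWithinAt_const.mul ?_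
      exact ContinuousWithinAt.comp (t := Ici t.toNNReal) (h.cadlag_K t.toNNReal).1
        continuous_real_toNNReal.continuousWithinAt
        fun s hs => Real.toNNReal_mono (le_of_lt hs)
  have hΨpos : ∀ t ∈ Icc (0 : ℝ) T, 0 < K t.toNNReal ∧ K t.toNNReal ≤ Ψ t := by
    intro t ht
    have := hKΨ t.toNNReal
    rw [Real.coe_toNNReal t ht.1] at this
    exact ⟨(h.mem_stateSpace _).1, this⟩
  have hgr := norm_le_gronwallBound_of_norm_deriv_right_le (δ := k) (K := m.A) (ε := 0)
    hcont hder (by simp [hΨ, abs_of_pos hk]) (fun t ht => by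
      obtain ⟨h1, h2⟩ := hΨpos t ⟨ht.1, ht.2.le⟩
      rw [Real.norm_of_nonneg (mul_pos m.A_pos h1).le, Real.norm_of_nonneg (h1.le.trans h2),
        add_zero]
      exact mul_le_mul_of_nonneg_left h2 m.A_pos.le) T ⟨hT0, le_rfl⟩
  rw [gronwallBound_ε0, sub_zero] at hgr
  exact (hKΨ T).trans ((le_abs_self _).trans hgr)

theorem P_le (h : IsStatePath m q k p f g K P) (hk : 0 < k)
    (hf : ∀ᵐ t ∂(volume.restrict (Ioi (0 : ℝ))), f t ≤ m.A * K t.toNNReal)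
    (hg : ∀ᵐ t ∂(volume.restrict (Ioi (0 : ℝ))), g t ≤ m.phi * (m.A * K t.toNNReal)) (T : ℝ≥0) :
    P T ≤ p + T * (m.phi * (m.A * (k * Real.exp (m.A * T)))) := by
  rw [h.eq_P T]
  have hT0 : (0 : ℝ) ≤ T := T.2
  have : ∫ s in (0 : ℝ)..T, g s ≤
      ∫ s in (0 : ℝ)..T, m.phi * (m.A * (k * Real.exp (m.A * T))) := by
    refine intervalIntegral.integral_mono_ae_restrict T.2 (h.integrable_g T) (by simp) ?_
    rw [← restrict_Ioc_eq_restrict_Icc]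
    filter_upwards [ae_restrict_of_ae_restrict_of_subset Ioc_subset_Ioi_self hg,
      ae_restrict_mem measurableSet_Ioc] with t ht htT
    refine ht.trans ?_
    have h1 := h.K_le hk hf t.toNNReal
    rw [Real.coe_toNNReal t htT.1.le] at h1
    have h2 : Real.exp (m.A * t) ≤ Real.exp (m.A * T) :=
      Real.exp_le_exp.2 (mul_le_mul_of_nonneg_left htT.2 m.A_pos.le)
    have h3 : K t.toNNReal ≤ k * Real.exp (m.A * T) :=
      h1.trans (mul_le_mul_of_nonneg_left h2 hk.le)
    have := m.A_pos.le
    have := m.phi_pos.le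
    gcongr
  rw [intervalIntegral.integral_const, sub_zero, smul_eq_mul] at this
  linarith

end IsStatePath

/-! ### Poisson increments and almost sure path regularity -/

/-- Apart from the vanishing term at `0`, `n` times the weight of `n` is `r` times the weight of `n
- 1`. -/
theorem hasSum_poisson_mean (r : ℝ≥0) :
    HasSum (fun n : ℕ => Real.exp (-r) * (r : ℝ) ^ n / (n.factorial : ℝ) * (n : ℝ)) r := by
  rw [← hasSum_nat_add_iff' 1]
  have h := (hasSum_one_poissonMeasure r).mul_right (r : ℝ)
  convert! h using 1
  · funext n
    have : ((n.factorial : ℕ) : ℝ) ≠ 0 := by positivity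
    rw [Nat.factorial_succ]
    push_cast
    field_simp
    ring
  · simp

theorem integrable_poissonMeasure_cast (r : ℝ≥0) :
    Integrable (fun n : ℕ => (n : ℝ)) (poissonMeasure r) := by
  rw [integrable_poissonMeasure_iff]
  simpa using (hasSum_poisson_mean r).summable

theorem integral_poissonMeasure_cast (r : ℝ≥0) :
    ∫ n : ℕ, (n : ℝ) ∂(poissonMeasure r) = r := by
  rw [integral_poissonMeasure]
  exact (hasSum_poisson_mean r).tsum_eq

/-- The complement has mass `e^{-r} (1 + r) ≥ (1 - r)(1 + r)`. The quadratic order rules out double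
jumps under grid refinement. -/
theorem poissonMeasure_two_le (r : ℝ≥0) :
    poissonMeasure r {n | 2 ≤ n} ≤ ENNReal.ofReal ((r : ℝ) ^ 2) := by
  have h1 : ({n : ℕ | 2 ≤ n} : Set ℕ) = ({0} ∪ {1})ᶜ := by
    ext n
    simp only [mem_ofPred_eq, mem_compl_iff, mem_union, mem_singleton_iff]
    omega
  rw [← ofReal_measureReal, h1, probReal_compl_eq_one_sub (by measurability),
    measureReal_union (by simp) (by simp), poissonMeasure_real_singleton,
    poissonMeasure_real_singleton]
  refine ENNReal.ofReal_le_ofReal ?_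
  have h2 : 1 - (r : ℝ) ≤ Real.exp (-r) := by
    have := Real.add_one_le_exp (-(r : ℝ)); linarith
  have h3 : (0 : ℝ) ≤ r := r.2
  simp only [pow_zero, pow_one, Nat.factorial_zero, Nat.factorial_one, Nat.cast_one]
  nlinarith

/-- The points of the uniform grid with `n` cells on `[0, T]`. -/
noncomputable def gridPoint (T : ℝ≥0) (n i : ℕ) : ℝ≥0 := T * i / n

theorem gridPoint_lt_succ {T : ℝ≥0} (hT : 0 < T) {n : ℕ} (hn : 0 < n) (i : ℕ) :
    gridPoint T n i < gridPoint T n (i + 1) := by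
  unfold gridPoint
  have : (0 : ℝ≥0) < n := by exact_mod_cast hn
  gcongr
  exact_mod_cast Nat.lt_succ_self i

theorem gridPoint_succ_sub {T : ℝ≥0} (hT : 0 < T) {n : ℕ} (hn : 0 < n) (i : ℕ) :
    gridPoint T n (i + 1) - gridPoint T n i = T / n := by
  rw [tsub_eq_iff_eq_add_of_le (gridPoint_lt_succ hT hn i).le]
  unfold gridPoint
  push_cast
  ring

theorem exists_mem_Ioc_gridPoint {T : ℝ≥0} {n : ℕ} (hn : 0 < n)
    {s : ℝ≥0} (hs : s ∈ Ioc 0 T) :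
    ∃ i < n, s ∈ Ioc (gridPoint T n i) (gridPoint T n (i + 1)) := by
  have hn' : (0 : ℝ≥0) < n := by exact_mod_cast hn
  have hex : ∃ i, s ≤ gridPoint T n i := ⟨n, by
    unfold gridPoint; rw [mul_div_assoc, div_self hn'.ne', mul_one]; exact hs.2⟩
  classical
  have hpos : Nat.find hex ≠ 0 := by
    intro h
    have := Nat.find_spec hex
    rw [h] at this
    simp only [gridPoint, Nat.cast_zero, mul_zero, zero_div] at this
    exact absurd hs.1 (not_lt.2 this)
  obtain ⟨i, hi⟩ := Nat.exists_eq_succ_of_ne_zero hpos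
  refine ⟨i, ?_, ?_, ?_⟩
  · have : Nat.find hex ≤ n := Nat.find_le (by
      unfold gridPoint; rw [mul_div_assoc, div_self hn'.ne', mul_one]; exact hs.2)
    omega
  · exact not_le.1 (Nat.find_min hex (m := i) (by omega))
  · have := Nat.find_spec hex
    rwa [hi] at this

theorem eventually_eq_of_rightCont {f : ℝ≥0 → ℕ} {t : ℝ≥0}
    (h : ContinuousWithinAt (fun s => (f s : ℝ)) (Ici t) t) : ∀ᶠ s in 𝓝[≥] t, f s = f t := by
  have h1 := h.eventually (Ioo_mem_nhds (show ((f t : ℕ) : ℝ) - 1 < f t by simp)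
    (show ((f t : ℕ) : ℝ) < f t + 1 by simp))
  filter_upwards [h1] with s hs
  have h2 : f t < f s + 1 := by
    have := hs.1
    rw [sub_lt_iff_lt_add] at this
    exact_mod_cast this
  have h3 : f s < f t + 1 := by exact_mod_cast hs.2
  omega

namespace IsPoissonProcess

variable {Ω : Type*} [mΩ : MeasurableSpace Ω] {μ : Measure Ω} {𝓕 : Filtration ℝ≥0 mΩ} {r : ℝ≥0}
  {q : ℝ≥0 → Ω → ℕ}

theorem measure_increment (hq : IsPoissonProcess μ 𝓕 r q) {s t : ℝ≥0} (hst : s < t)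
    (S : Set ℤ) : μ {ω | (q t ω : ℤ) - (q s ω : ℤ) ∈ S} =
      poissonMeasure (r * (t - s)) {n : ℕ | (n : ℤ) ∈ S} := by
  have h := (hq.law s t hst).measure_eq (p := fun x => x ∈ S) (by measurability)
  rw [h, Measure.map_apply (by fun_prop) (by measurability)]
  rfl

theorem ae_le (hq : IsPoissonProcess μ 𝓕 r q) {s t : ℝ≥0} (hst : s < t) :
    ∀ᵐ ω ∂μ, q s ω ≤ q t ω := by
  rw [ae_iff]
  have h := hq.measure_increment hst (Iio 0)
  have h0 : {n : ℕ | (n : ℤ) ∈ Iio 0} = ∅ := by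
    ext n
    simp
  rw [h0, measure_empty] at h
  convert h using 2
  ext ω
  simp only [mem_ofPred_eq, mem_Iio]
  omega

/-- The order relations hold almost surely on a countable dense set of times. An integer-valued
right-continuous path is constant just after each time, so they extend to all times. -/
theorem ae_monotone (hq : IsPoissonProcess μ 𝓕 r q) : ∀ᵐ ω ∂μ, Monotone (fun t => q t ω) := by
  obtain ⟨D, hDc, hDd⟩ := TopologicalSpace.exists_countable_dense ℝ≥0
  have h1 : ∀ᵐ ω ∂μ, ∀ s ∈ D, ∀ t ∈ D, s < t → q s ω ≤ q t ω := by
    refine (ae_ball_iff hDc).2 fun s _ => (ae_ball_iff hDc).2 fun t _ => ?_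
    by_cases hst : s < t
    · filter_upwards [hq.ae_le hst] with ω h _ using h
    · exact Eventually.of_forall fun ω h => absurd h hst
  filter_upwards [h1, hq.cadlag] with ω hD hc s t hst
  rcases hst.eq_or_lt with rfl | hst
  · exact le_rfl
  obtain ⟨u, hu, hsu⟩ := (mem_nhdsGE_iff_exists_Ico_subset' hst).1
    (eventually_eq_of_rightCont (hc s).1)
  obtain ⟨w, hw, htw⟩ := (mem_nhdsGE_iff_exists_Ico_subset' (show t < t + 1 by simp)).1
    (eventually_eq_of_rightCont (hc t).1)
  obtain ⟨s', hs'D, hs'⟩ := hDd.exists_between (lt_min (show s < u from hu) hst)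
  obtain ⟨t', ht'D, ht'⟩ := hDd.exists_between (show t < w from hw)
  have e1 : q s' ω = q s ω := hsu ⟨hs'.1.le, hs'.2.trans_le (min_le_left _ _)⟩
  have e2 : q t' ω = q t ω := htw ⟨ht'.1.le, ht'.2⟩
  have := hD s' hs'D t' ht'D ((hs'.2.trans_le (min_le_right _ _)).trans ht'.1)
  change q s ω ≤ q t ω
  omega

/-- For a monotone path, a jump larger than one makes the increment over its grid cell at least two.
The `n` cells together allow this with probability at most `n (rT/n)² → 0`. Only monotonicity and
subadditivity of `μ` enter, so the event need not be shown measurable. -/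
theorem measure_big_jump_eq_zero (hq : IsPoissonProcess μ 𝓕 r q) {T : ℝ≥0} (hT : 0 < T) :
    μ {ω | Monotone (fun t => q t ω) ∧ ∃ s ∈ Ioc 0 T,
      1 < (q s ω : ℝ) - Function.leftLim (fun t => (q t ω : ℝ)) s} = 0 := by
  set E := {ω | Monotone (fun t => q t ω) ∧ ∃ s ∈ Ioc 0 T,
      1 < (q s ω : ℝ) - Function.leftLim (fun t => (q t ω : ℝ)) s} with hE
  have hbound : ∀ n : ℕ, 0 < n → μ E ≤ ENNReal.ofReal ((r * T : ℝ) ^ 2 / n) := by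
    intro n hn
    have hsub : E ⊆ ⋃ i ∈ Finset.range n,
        {ω | (q (gridPoint T n (i + 1)) ω : ℤ) - (q (gridPoint T n i) ω : ℤ) ∈ Ici 2} := by
      rintro ω ⟨hmono, s, hs, hjump⟩
      obtain ⟨i, hi, hsi⟩ := exists_mem_Ioc_gridPoint hn hs
      refine mem_biUnion (Finset.mem_coe.2 (Finset.mem_range.2 hi)) ?_
      have hmono' : Monotone (fun t => (q t ω : ℝ)) := fun a b h => Nat.cast_le.2 (hmono h)
      have h1 := hmono'.le_leftLim hsi.1
      have h2 := hmono' hsi.2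
      simp only at h1 h2
      have h3 : (q (gridPoint T n i) ω : ℝ) + 1 < q (gridPoint T n (i + 1)) ω := by linarith
      have h4 : q (gridPoint T n i) ω + 1 < q (gridPoint T n (i + 1)) ω := by exact_mod_cast h3
      simp only [mem_Ici, mem_ofPred_eq]
      omega
    have hcell : ∀ i, μ {ω | (q (gridPoint T n (i + 1)) ω : ℤ) - (q (gridPoint T n i) ω : ℤ)
        ∈ Ici 2} ≤ ENNReal.ofReal ((r * (T / n) : ℝ) ^ 2) := by
      intro i
      rw [hq.measure_increment (gridPoint_lt_succ hT hn i), gridPoint_succ_sub hT hn]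
      have : {k : ℕ | (k : ℤ) ∈ Ici 2} = {k : ℕ | 2 ≤ k} := by
        ext k; simp only [mem_Ici, mem_ofPred_eq]; omega
      rw [this]
      simpa using poissonMeasure_two_le (r * (T / n))
    calc μ E ≤ ∑ i ∈ Finset.range n, μ {ω | (q (gridPoint T n (i + 1)) ω : ℤ)
          - (q (gridPoint T n i) ω : ℤ) ∈ Ici 2} :=
        (measure_mono hsub).trans (measure_biUnion_finset_le _ _)
      _ ≤ ∑ _i ∈ Finset.range n, ENNReal.ofReal ((r * (T / n) : ℝ) ^ 2) :=
        Finset.sum_le_sum fun i _ => hcell i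
      _ = ENNReal.ofReal ((r * T : ℝ) ^ 2 / n) := by
        rw [Finset.sum_const, Finset.card_range, nsmul_eq_mul, ← ENNReal.ofReal_natCast,
          ← ENNReal.ofReal_mul (by positivity)]
        congr 1
        have : (n : ℝ) ≠ 0 := by exact_mod_cast hn.ne'
        field_simp
  have hlim : Tendsto (fun n : ℕ => ENNReal.ofReal ((r * T : ℝ) ^ 2 / n)) atTop (𝓝 0) := by
    rw [← ENNReal.ofReal_zero]
    exact ENNReal.tendsto_ofReal (tendsto_const_div_atTop_nhds_zero_nat _)
  refine le_antisymm (ge_of_tendsto hlim ?_) zero_le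
  filter_upwards [eventually_gt_atTop 0] with n hn using hbound n hn

theorem ae_isCountingPath (hq : IsPoissonProcess μ 𝓕 r q) :
    ∀ᵐ ω ∂μ, IsCountingPath (fun t => q t ω) := by
  have h1 : ∀ᵐ ω ∂μ, ∀ N : ℕ, ¬ (Monotone (fun t => q t ω) ∧ ∃ s ∈ Ioc 0 ((N : ℝ≥0) + 1),
      1 < (q s ω : ℝ) - Function.leftLim (fun t => (q t ω : ℝ)) s) := by
    refine ae_all_iff.2 fun N => ?_
    rw [ae_iff]
    simpa only [not_not] using hq.measure_big_jump_eq_zero (show (0 : ℝ≥0) < N + 1 by positivity)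
  filter_upwards [h1, hq.ae_monotone, hq.cadlag] with ω hω hmono hc
  refine ⟨hmono, fun t => (hc t).1, fun s => ?_⟩
  rcases eq_or_ne s 0 with rfl | hs
  · rw [leftLim_eq_of_isBot (fun x => zero_le), sub_self]
    exact zero_le_one
  · obtain ⟨N, hN⟩ := exists_nat_ge s
    by_contra hcon
    refine hω N ⟨hmono, s, ⟨pos_iff_ne_zero.2 hs, hN.trans (by simp)⟩, not_le.1 hcon⟩

theorem integrable_increment (hq : IsPoissonProcess μ 𝓕 r q) {s t : ℝ≥0} (hst : s < t) :
    Integrable (fun ω => (q t ω : ℝ) - q s ω) μ ∧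
      ∫ ω, ((q t ω : ℝ) - q s ω) ∂μ = r * (t - s) := by
  have hl := hq.law s t hst
  have hi : Integrable (fun z : ℤ => (z : ℝ))
      ((poissonMeasure (r * (t - s))).map (Nat.cast : ℕ → ℤ)) := by
    rw [integrable_map_measure (by fun_prop) (by fun_prop)]
    simpa [Function.comp_def] using integrable_poissonMeasure_cast (r * (t - s))
  have heq : (fun ω => (q t ω : ℝ) - q s ω) =
      (fun z : ℤ => (z : ℝ)) ∘ (fun ω => (q t ω : ℤ) - (q s ω : ℤ)) := by
    funext ω
    simp
  constructor
  · rw [heq]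
    rw [← hl.map_eq] at hi
    exact hi.comp_aemeasurable hl.aemeasurable
  · have := hl.integral_comp (f := fun z : ℤ => (z : ℝ)) (by fun_prop)
    rw [heq, this, integral_map (by fun_prop) (by fun_prop)]
    simp only [Int.cast_natCast, integral_poissonMeasure_cast]
    rw [NNReal.coe_mul, NNReal.coe_sub hst.le]

end IsPoissonProcess

/-! ### Compensated Riemann sums and their mean zero limit -/

theorem gridPoint_monotone (T : ℝ≥0) (n : ℕ) : Monotone (gridPoint T n) := by
  intro i j hij
  unfold gridPoint
  have : (i : ℝ≥0) ≤ j := by exact_mod_cast hij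
  gcongr

theorem gridPoint_le {T : ℝ≥0} {n i : ℕ} (hi : i ≤ n) : gridPoint T n i ≤ T := by
  refine (gridPoint_monotone T n hi).trans ?_
  unfold gridPoint
  rw [mul_div_assoc]
  exact mul_le_of_le_one_right zero_le (div_self_le_one _)

/-- The left-continuous step function that approximates `h` on the grid. -/
noncomputable def gridStep (h : ℝ≥0 → ℝ) (T : ℝ≥0) (n : ℕ) (s : ℝ≥0) : ℝ :=
  ∑ i ∈ Finset.range n,
    h (gridPoint T n i) * (Ioc (gridPoint T n i) (gridPoint T n (i + 1))).indicator (fun _ => 1) s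

theorem exists_gridStep_eq (h : ℝ≥0 → ℝ) {T : ℝ≥0} {n : ℕ} (hn : 0 < n) {s : ℝ≥0}
    (hs : s ∈ Ioc 0 T) :
    ∃ i < n, s ∈ Ioc (gridPoint T n i) (gridPoint T n (i + 1)) ∧
      gridStep h T n s = h (gridPoint T n i) := by
  obtain ⟨i, hi, hsi⟩ := exists_mem_Ioc_gridPoint hn hs
  refine ⟨i, hi, hsi, ?_⟩
  unfold gridStep
  rw [Finset.sum_eq_single i]
  · rw [indicator_of_mem hsi, mul_one]
  · intro j _ hji
    rw [indicator_of_notMem, mul_zero]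
    intro hsj
    rcases lt_or_gt_of_ne hji with hlt | hlt
    · exact absurd (hsj.2.trans (gridPoint_monotone T n hlt)) (not_le.2 hsi.1)
    · exact absurd (hsi.2.trans (gridPoint_monotone T n hlt)) (not_le.2 hsj.1)
  · intro hni
    exact absurd (Finset.mem_range.2 hi) hni

/-- Cells are open on the left, so the sampled grid point lies strictly before `s`, and within `T /
n` of it; the limit is therefore the left limit, even when `s` is a grid point. -/
theorem tendsto_gridStep {h : ℝ≥0 → ℝ} {T s : ℝ≥0} (hT : 0 < T) (hs : s ∈ Ioc 0 T) {l : ℝ}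
    (hl : Tendsto h (𝓝[<] s) (𝓝 l)) : Tendsto (fun n => gridStep h T n s) atTop (𝓝 l) := by
  intro U hU
  obtain ⟨a, has, haU⟩ := (mem_nhdsLT_iff_exists_Ioo_subset' hs.1).1 (hl hU)
  have hlim : Tendsto (fun n : ℕ => (T : ℝ) / n) atTop (𝓝 0) :=
    tendsto_const_div_atTop_nhds_zero_nat _
  have hpos : (0 : ℝ) < s - a := sub_pos.2 (NNReal.coe_lt_coe.2 has)
  rw [mem_map]
  filter_upwards [eventually_gt_atTop 0, hlim.eventually (Iio_mem_nhds hpos)] with n hn hna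
  obtain ⟨i, -, hsi, heq⟩ := exists_gridStep_eq h hn hs
  change gridStep h T n s ∈ U
  rw [heq]
  refine haU ⟨?_, hsi.1⟩
  have h1 := gridPoint_succ_sub hT hn i
  have h2 : ((gridPoint T n (i + 1) : ℝ≥0) : ℝ) - gridPoint T n i = T / n := by
    rw [← NNReal.coe_sub (gridPoint_lt_succ hT hn i).le, h1]
    push_cast
    rfl
  have h3 : (s : ℝ) ≤ gridPoint T n (i + 1) := NNReal.coe_le_coe.2 hsi.2
  have h4 : (T : ℝ) / n < s - a := hna
  rw [← NNReal.coe_lt_coe]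
  linarith

theorem measurable_gridStep (h : ℝ≥0 → ℝ) (T : ℝ≥0) (n : ℕ) : Measurable (gridStep h T n) := by
  unfold gridStep
  exact Finset.measurable_sum _ fun i _ =>
    (measurable_const.indicator measurableSet_Ioc).const_mul _

theorem integral_indicator_toNNReal {a b T : ℝ≥0} (hab : a ≤ b) (hbT : b ≤ T) :
    IntervalIntegrable (fun s : ℝ => (Ioc a b).indicator (fun _ => (1 : ℝ)) s.toNNReal)
      volume 0 T ∧
    ∫ s in (0 : ℝ)..T, (Ioc a b).indicator (fun _ => (1 : ℝ)) s.toNNReal = b - a := by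
  have hT : (0 : ℝ) ≤ T := T.2
  have ha : (0 : ℝ) ≤ a := a.2
  have hbT' : (b : ℝ) ≤ T := NNReal.coe_le_coe.2 hbT
  have hab' : (a : ℝ) ≤ b := NNReal.coe_le_coe.2 hab
  have heq : ∀ s ∈ uIoc (0 : ℝ) T, (Ioc (a : ℝ) b).indicator (fun _ => (1 : ℝ)) s =
      (Ioc a b).indicator (fun _ => (1 : ℝ)) s.toNNReal := by
    intro s hs
    rw [uIoc_of_le hT] at hs
    have : s ∈ Ioc (a : ℝ) b ↔ s.toNNReal ∈ Ioc a b := by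
      rw [mem_Ioc, mem_Ioc, ← NNReal.coe_lt_coe, ← NNReal.coe_le_coe, Real.coe_toNNReal s hs.1.le]
    by_cases h : s ∈ Ioc (a : ℝ) b
    · rw [indicator_of_mem h, indicator_of_mem (this.1 h)]
    · rw [indicator_of_notMem h, indicator_of_notMem (fun h' => h (this.2 h'))]
  have hint : Integrable ((Ioc (a : ℝ) b).indicator (fun _ => (1 : ℝ))) volume :=
    (integrable_indicator_iff measurableSet_Ioc).2 (by simp)
  refine ⟨(hint.intervalIntegrable).congr heq, ?_⟩
  rw [← intervalIntegral.integral_congr_ae (Eventually.of_forall heq),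
    intervalIntegral.integral_of_le hT, setIntegral_indicator measurableSet_Ioc,
    Ioc_inter_Ioc, max_eq_right ha, min_eq_right hbT', ← intervalIntegral.integral_of_le hab']
  simp

/-- Compensated Riemann sums along the grid. -/
noncomputable def compensatedSum (r : ℝ≥0) (h : ℝ≥0 → ℝ) (q : ℝ≥0 → ℕ) (T : ℝ≥0) (n : ℕ) : ℝ :=
  ∑ i ∈ Finset.range n, h (gridPoint T n i) *
    (((q (gridPoint T n (i + 1)) : ℝ) - q (gridPoint T n i))
      - r * (gridPoint T n (i + 1) - gridPoint T n i))

/-- The sum equals that of `gridStep` over the jumps minus `r` times its time integral. The first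
part is a finite sum with fixed index set, the second converges by domination by `M`. -/
theorem IsCountingPath.tendsto_compensatedSum {q : ℝ≥0 → ℕ} (hq : IsCountingPath q) (r : ℝ≥0)
    {h l : ℝ≥0 → ℝ} {T : ℝ≥0} (hT : 0 < T) {M : ℝ} (hM : ∀ t ≤ T, |h t| ≤ M)
    (hl : ∀ s ∈ Ioc 0 T, Tendsto h (𝓝[<] s) (𝓝 (l s))) :
    Tendsto (compensatedSum r h q T) atTop
      (𝓝 (jumpIntegral l (fun s => (q s : ℝ)) T - r * ∫ s in (0 : ℝ)..T, l s.toNNReal)) := by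
  have hT' : (0 : ℝ) ≤ T := T.2
  have hle : ∀ n i, gridPoint T n i ≤ gridPoint T n (i + 1) := fun n i =>
    gridPoint_monotone T n (Nat.le_succ i)
  have hsplit : ∀ n, compensatedSum r h q T n =
      ∑ s ∈ (hq.finite_jumpTimes T).toFinset, gridStep h T n s
        - r * ∫ s in (0 : ℝ)..T, gridStep h T n s.toNNReal := by
    intro n
    have h1 : ∫ s in (0 : ℝ)..T, gridStep h T n s.toNNReal = ∑ i ∈ Finset.range n,
        h (gridPoint T n i) * (gridPoint T n (i + 1) - gridPoint T n i) := by
      unfold gridStep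
      rw [intervalIntegral.integral_finsetSum]
      · refine Finset.sum_congr rfl fun i hi => ?_
        rw [intervalIntegral.integral_const_mul, (integral_indicator_toNNReal (hle n i)
          (gridPoint_le (Finset.mem_range.1 hi))).2]
      · intro i hi
        exact (integral_indicator_toNNReal (hle n i)
          (gridPoint_le (Finset.mem_range.1 hi))).1.const_mul _
    have h2 : ∑ s ∈ (hq.finite_jumpTimes T).toFinset, gridStep h T n s =
        ∑ i ∈ Finset.range n,
          h (gridPoint T n i) * ((q (gridPoint T n (i + 1)) : ℝ) - q (gridPoint T n i)) := by
      unfold gridStep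
      rw [Finset.sum_comm]
      refine Finset.sum_congr rfl fun i hi => ?_
      rw [← Finset.mul_sum, hq.sub_eq_sum_indicator (hle n i) (gridPoint_le (Finset.mem_range.1 hi))]
    rw [h1, h2, Finset.mul_sum, ← Finset.sum_sub_distrib]
    unfold compensatedSum
    exact Finset.sum_congr rfl fun i _ => by ring
  rw [funext hsplit, hq.jumpIntegral_eq_sum]
  refine Tendsto.sub (tendsto_finsetSum _ fun s hs => ?_) (Tendsto.const_mul _ ?_)
  · rw [Set.Finite.mem_toFinset] at hs
    have hs' : s ∈ Ioc 0 T := ⟨IsCountingPath.pos_of_mem_jumpTimes hs.1, hs.2⟩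
    exact tendsto_gridStep hT hs' (hl s hs')
  · have hmem : ∀ s ∈ uIoc (0 : ℝ) T, s.toNNReal ∈ Ioc 0 T := by
      intro s hs
      rw [uIoc_of_le hT'] at hs
      exact ⟨Real.toNNReal_pos.2 hs.1, Real.toNNReal_le_iff_le_coe.2 hs.2⟩
    refine intervalIntegral.tendsto_integral_filter_of_dominated_convergence (fun _ => M) ?_ ?_
      (by simp) ?_
    · exact Eventually.of_forall fun n =>
        ((measurable_gridStep h T n).comp measurable_real_toNNReal).aestronglyMeasurable
    · filter_upwards [eventually_gt_atTop 0] with n hn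
      refine Eventually.of_forall fun s hs => ?_
      obtain ⟨i, hi, -, heq⟩ := exists_gridStep_eq h hn (hmem s hs)
      rw [heq]
      exact hM _ (gridPoint_le hi.le)
    · exact Eventually.of_forall fun s hs => tendsto_gridStep hT (hmem s hs) (hl _ (hmem s hs))

/-- Both kinds of increments are nonnegative and telescope, which gives a bound independent of `n`
and integrable over `Ω`. -/
theorem abs_compensatedSum_le {q : ℝ≥0 → ℕ} (hq : Monotone q) (r : ℝ≥0)
    {h : ℝ≥0 → ℝ} {T : ℝ≥0} {M : ℝ} (hM : ∀ t ≤ T, |h t| ≤ M) (n : ℕ) :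
    |compensatedSum r h q T n| ≤ M * (((q T : ℝ) - q 0) + r * T) := by
  have hM0 : 0 ≤ M := (abs_nonneg _).trans (hM 0 zero_le)
  have hle : ∀ i, (gridPoint T n i : ℝ) ≤ gridPoint T n (i + 1) := fun i =>
    NNReal.coe_le_coe.2 (gridPoint_monotone T n (Nat.le_succ i))
  have hqle : ∀ i, (q (gridPoint T n i) : ℝ) ≤ q (gridPoint T n (i + 1)) := fun i =>
    Nat.cast_le.2 (hq (gridPoint_monotone T n (Nat.le_succ i)))
  have hr : (0 : ℝ) ≤ r := r.2
  calc |compensatedSum r h q T n|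
      ≤ ∑ i ∈ Finset.range n, M *
        (((q (gridPoint T n (i + 1)) : ℝ) - q (gridPoint T n i))
          + r * (gridPoint T n (i + 1) - gridPoint T n i)) := by
        refine (Finset.abs_sum_le_sum_abs _ _).trans (Finset.sum_le_sum fun i hi => ?_)
        rw [abs_mul]
        refine mul_le_mul (hM _ (gridPoint_le (Finset.mem_range.1 hi).le)) ?_ (abs_nonneg _) hM0
        refine (abs_sub _ _).trans (le_of_eq ?_)
        rw [abs_of_nonneg (sub_nonneg.2 (hqle i)),
          abs_of_nonneg (mul_nonneg hr (sub_nonneg.2 (hle i)))]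
    _ = M * (((q (gridPoint T n n) : ℝ) - q (gridPoint T n 0))
          + r * (gridPoint T n n - gridPoint T n 0)) := by
        rw [← Finset.mul_sum, Finset.sum_add_distrib, ← Finset.mul_sum,
          Finset.sum_range_sub (fun i => (q (gridPoint T n i) : ℝ)),
          Finset.sum_range_sub (fun i => (gridPoint T n i : ℝ))]
    _ ≤ M * (((q T : ℝ) - q 0) + r * T) := by
        have h0 : gridPoint T n 0 = 0 := by simp [gridPoint]
        have h1 : (q (gridPoint T n n) : ℝ) ≤ q T := Nat.cast_le.2 (hq (gridPoint_le le_rfl))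
        have h2 : (gridPoint T n n : ℝ) ≤ T := NNReal.coe_le_coe.2 (gridPoint_le le_rfl)
        rw [h0, NNReal.coe_zero, sub_zero]
        gcongr

namespace IsPoissonProcess

variable {Ω : Type*} [mΩ : MeasurableSpace Ω] {μ : Measure Ω} [IsProbabilityMeasure μ]
  {𝓕 : Filtration ℝ≥0 mΩ} {r : ℝ≥0} {q : ℝ≥0 → Ω → ℕ}

/-- The increment is independent of `𝓕 s` and centred by its Poisson mean, so the expectation of the
product factors. -/
theorem integral_mul_compensated_increment (hq : IsPoissonProcess μ 𝓕 r q) {s t : ℝ≥0}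
    (hst : s < t) {X : Ω → ℝ} (hX : Measurable[𝓕 s] X) (hXi : Integrable X μ) :
    Integrable (fun ω => X ω * (((q t ω : ℝ) - q s ω) - r * (t - s))) μ ∧
      ∫ ω, X ω * (((q t ω : ℝ) - q s ω) - r * (t - s)) ∂μ = 0 := by
  obtain ⟨hi, hmean⟩ := hq.integrable_increment hst
  have hY : Integrable (fun ω => ((q t ω : ℝ) - q s ω) - r * (t - s)) μ :=
    hi.sub (integrable_const _)
  have hind : IndepFun X (fun ω => ((q t ω : ℝ) - q s ω) - r * (t - s)) μ := by
    have h1 : IndepFun (fun ω => (q t ω : ℤ) - (q s ω : ℤ)) X μ := by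
      rw [IndepFun_iff_Indep]
      exact indep_of_indep_of_le_right (hq.indep s t hst) hX.comap_le
    have h2 := h1.symm.comp measurable_id
      (show Measurable (fun z : ℤ => (z : ℝ) - r * (t - s)) by fun_prop)
    convert! h2 using 1
    funext ω
    simp
  refine ⟨hind.integrable_mul hXi hY, ?_⟩
  have := hind.integral_mul_eq_mul_integral hXi.aestronglyMeasurable hY.aestronglyMeasurable
  refine (Eq.trans ?_ this).trans ?_
  · rfl
  · rw [integral_sub hi (integrable_const _), hmean]
    simp

/-- The compensated jump integral of the left limits of a bounded adapted process has mean zero. -/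
theorem integral_compensated_jumpIntegral (hq : IsPoissonProcess μ 𝓕 r q) {h l : ℝ≥0 → Ω → ℝ}
    (hh : Adapted 𝓕 h) {T : ℝ≥0} (hT : 0 < T) {M : ℝ}
    (hM : ∀ᵐ ω ∂μ, ∀ t ≤ T, |h t ω| ≤ M)
    (hl : ∀ᵐ ω ∂μ, ∀ s ∈ Ioc 0 T, Tendsto (fun t => h t ω) (𝓝[<] s) (𝓝 (l s ω))) :
    Integrable (fun ω => jumpIntegral (fun s => l s ω) (fun s => (q s ω : ℝ)) T
      - r * ∫ s in (0 : ℝ)..T, l s.toNNReal ω) μ ∧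
    ∫ ω, (jumpIntegral (fun s => l s ω) (fun s => (q s ω : ℝ)) T
      - r * ∫ s in (0 : ℝ)..T, l s.toNNReal ω) ∂μ = 0 := by
  set S : ℕ → Ω → ℝ := fun n ω =>
    compensatedSum r (fun t => h t ω) (fun t => q t ω) T n with hS
  have hterm : ∀ n, ∀ i ∈ Finset.range n,
      Integrable (fun ω => h (gridPoint T n i) ω *
        (((q (gridPoint T n (i + 1)) ω : ℝ) - q (gridPoint T n i) ω)
          - r * (gridPoint T n (i + 1) - gridPoint T n i))) μ ∧
      ∫ ω, h (gridPoint T n i) ω *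
        (((q (gridPoint T n (i + 1)) ω : ℝ) - q (gridPoint T n i) ω)
          - r * (gridPoint T n (i + 1) - gridPoint T n i)) ∂μ = 0 := by
    intro n i hi
    have hi := Finset.mem_range.1 hi
    refine hq.integral_mul_compensated_increment
      (gridPoint_lt_succ hT ((Nat.zero_le i).trans_lt hi) i) (hh _) ?_
    refine Integrable.of_bound ((hh _).mono (𝓕.le _) le_rfl).aestronglyMeasurable M ?_
    filter_upwards [hM] with ω hω using hω _ (gridPoint_le hi.le)
  have hSint : ∀ n, Integrable (S n) μ := fun n =>
    integrable_finsetSum _ fun i hi => (hterm n i hi).1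
  have hSzero : ∀ n, ∫ ω, S n ω ∂μ = 0 := fun n => by
    simp only [hS, compensatedSum]
    rw [integral_finsetSum _ fun i hi => (hterm n i hi).1]
    exact Finset.sum_eq_zero fun i hi => (hterm n i hi).2
  have hlim : ∀ᵐ ω ∂μ, Tendsto (fun n => S n ω) atTop
      (𝓝 (jumpIntegral (fun s => l s ω) (fun s => (q s ω : ℝ)) T
        - r * ∫ s in (0 : ℝ)..T, l s.toNNReal ω)) := by
    filter_upwards [hq.ae_isCountingPath, hM, hl] with ω h1 h2 h3
    exact h1.tendsto_compensatedSum r hT h2 h3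
  have hbound : ∀ n, ∀ᵐ ω ∂μ, ‖S n ω‖ ≤ M * (((q T ω : ℝ) - q 0 ω) + r * T) := by
    intro n
    filter_upwards [hq.ae_isCountingPath, hM] with ω h1 h2
    exact abs_compensatedSum_le h1.mono r h2 n
  have hboundi : Integrable (fun ω => M * (((q T ω : ℝ) - q 0 ω) + r * T)) μ :=
    ((hq.integrable_increment hT).1.add (integrable_const _)).const_mul _
  refine ⟨?_, ?_⟩
  · refine hboundi.mono' (aestronglyMeasurable_of_tendsto_ae atTop
      (fun n => (hSint n).aestronglyMeasurable) hlim) ?_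
    filter_upwards [hlim, ae_all_iff.2 hbound] with ω h1 h2
    exact le_of_tendsto' h1.norm h2
  · have := tendsto_integral_of_dominated_convergence _
      (fun n => (hSint n).aestronglyMeasurable) hboundi hbound hlim
    simp only [hSzero] at this
    exact (tendsto_nhds_unique this tendsto_const_nhds)

end IsPoissonProcess

/-! ### Jump sizes of `v` and the compensated Itô formula -/

namespace Params

variable (m : Params)

theorem continuousOn_survival : ContinuousOn (fun z : ℝ × ℝ => m.survival z.1 z.2) stateSpace := by
  intro z hz
  refine ContinuousAt.continuousWithinAt ?_
  unfold survival
  refine Real.continuous_exp.continuousAt.comp (ContinuousAt.neg ?_)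
  refine (continuousAt_const.mul ?_).mul ?_
  · exact continuousAt_snd.rpow_const (Or.inl (ne_of_gt hz.2))
  · exact continuousAt_fst.rpow_const (Or.inl (ne_of_gt hz.1))

variable {m} {v : ℝ × ℝ → ℝ}

theorem survival_mul_mem {z : ℝ × ℝ} (hz : z ∈ stateSpace) :
    (m.survival z.1 z.2 * z.1, z.2) ∈ stateSpace :=
  ⟨mul_pos (m.survival_pos _ _) hz.1, hz.2⟩

theorem continuousOn_jumpSize (hv : ContinuousOn v stateSpace) :
    ContinuousOn (m.jumpSize v) stateSpace := by
  unfold jumpSize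
  refine ContinuousOn.sub ?_ hv
  exact hv.comp ((m.continuousOn_survival.mul continuousOn_fst).prodMk continuousOn_snd)
    fun z hz => survival_mul_mem hz

theorem abs_jumpSize_le {B₁ B₂ M : ℝ}
    (hM : ∀ z ∈ stateSpace, z.1 ≤ B₁ → z.2 ≤ B₂ → |v z| ≤ M) {z : ℝ × ℝ} (hz : z ∈ stateSpace)
    (h1 : z.1 ≤ B₁) (h2 : z.2 ≤ B₂) : |m.jumpSize v z| ≤ 2 * M := by
  have h3 := hM z hz h1 h2
  have hz1 : 0 < z.1 := hz.1
  have hz2 : 0 < z.2 := hz.2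
  have h4 := hM _ (survival_mul_mem (m := m) hz)
    ((mul_le_of_le_one_left hz1.le (m.survival_le_one hz1.le hz2.le)).trans h1) h2
  unfold jumpSize
  refine (abs_sub _ _).trans ?_
  linarith

end Params

/-- `v` is regular only on the state space. Extension by zero is Borel everywhere and agrees with it
along almost every path. -/
theorem measurable_indicator_of_continuousOn {w : ℝ × ℝ → ℝ} (hw : ContinuousOn w stateSpace) :
    Measurable (stateSpace.indicator w) := by
  classical
  rw [← piecewise_eq_indicator]
  exact hw.measurable_piecewise continuousOn_const isOpen_stateSpace.measurableSet

/-- Continuity alone would not suffice: the state may approach the axes, where `v` could be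
unbounded. -/
theorem PolynomialGrowth.exists_bound {v : ℝ × ℝ → ℝ} (hv : PolynomialGrowth v) (B₁ B₂ : ℝ) :
    ∃ M, ∀ z ∈ stateSpace, z.1 ≤ B₁ → z.2 ≤ B₂ → |v z| ≤ M := by
  obtain ⟨c, γ, δ, hc, hγ, hδ, h⟩ := hv
  refine ⟨c * (1 + B₁ ^ γ + B₂ ^ δ), fun z hz h1 h2 => (h z.1 z.2 hz).trans ?_⟩
  have := Real.rpow_le_rpow (le_of_lt hz.1) h1 hγ
  have := Real.rpow_le_rpow (le_of_lt hz.2) h2 hδ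
  exact mul_le_mul_of_nonneg_left (by linarith) hc.le

namespace IsStatePath

variable {m : Params} {q : ℝ≥0 → ℕ} {k p : ℝ} {f g : ℝ → ℝ} {K P : ℝ≥0 → ℝ} {v : ℝ × ℝ → ℝ}

theorem tendsto_P (h : IsStatePath m q k p f g K P) (s : ℝ≥0) :
    Tendsto P (𝓝[<] s) (𝓝 (P s)) := by
  have hcont : ContinuousOn (fun t : ℝ => ∫ r in (0 : ℝ)..t, g r) (uIcc 0 s) :=
    intervalIntegral.continuousOn_primitive_interval' (h.integrable_g s) left_mem_uIcc
  have hcoe : Tendsto (fun t : ℝ≥0 => (t : ℝ)) (𝓝[<] s) (𝓝[uIcc (0 : ℝ) s] (s : ℝ)) := by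
    refine tendsto_nhdsWithin_iff.2
      ⟨(NNReal.continuous_coe.tendsto s).mono_left nhdsWithin_le_nhds, ?_⟩
    filter_upwards [self_mem_nhdsWithin] with t ht
    rw [uIcc_of_le (show (0 : ℝ) ≤ s from s.2)]
    exact ⟨t.2, NNReal.coe_le_coe.2 (le_of_lt ht)⟩
  rw [funext h.eq_P]
  exact ((hcont s right_mem_uIcc).tendsto.comp hcoe).const_add p

theorem tendsto_jumpSize (h : IsStatePath m q k p f g K P) (hv : ContinuousOn v stateSpace)
    {s : ℝ≥0} (hs : 0 < s) :
    Tendsto (fun t : ℝ≥0 => Real.exp (-m.rho * t) * m.jumpSize v (K t, P t)) (𝓝[<] s)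
      (𝓝 (Real.exp (-m.rho * s) * m.jumpSize v (Function.leftLim K s, P s))) := by
  have hz : (Function.leftLim K s, P s) ∈ stateSpace :=
    ⟨h.leftLim_K_pos hs, (h.mem_stateSpace s).2⟩
  have h1 := ((Params.continuousOn_jumpSize (m := m) hv).continuousAt
    (isOpen_stateSpace.mem_nhds hz)).tendsto.comp ((h.tendsto_leftLim s).prodMk_nhds (h.tendsto_P s))
  refine Tendsto.mul ?_ h1
  have hc : Continuous fun t : ℝ≥0 => Real.exp (-m.rho * t) := by fun_prop
  exact (hc.tendsto s).mono_left nhdsWithin_le_nhds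

/-- Itô's formula with compensated jumps. -/
theorem ito_formula_compensated (h : IsStatePath m q k p f g K P)
    (hv : ContDiffOn ℝ 2 v stateSpace) {T : ℝ≥0} (hT : 0 < T) {M : ℝ}
    (hM : ∀ t ≤ T, |m.jumpSize v (K t, P t)| ≤ M) :
    IntervalIntegrable (fun t : ℝ =>
      chainIntegrand m.rho v (fun t => K t.toNNReal) (fun t => P t.toNNReal) f g t
        + m.lam * (Real.exp (-m.rho * t) * m.jumpSize v (K t.toNNReal, P t.toNNReal)))
      volume 0 T ∧
    Real.exp (-m.rho * T) * v (K T, P T) - v (k, p) =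
      (∫ t in (0 : ℝ)..T,
        (chainIntegrand m.rho v (fun t => K t.toNNReal) (fun t => P t.toNNReal) f g t
        + m.lam * (Real.exp (-m.rho * t) * m.jumpSize v (K t.toNNReal, P t.toNNReal))))
      + (jumpIntegral (fun s => Real.exp (-m.rho * s) * m.jumpSize v (Function.leftLim K s, P s))
          (fun s => (q s : ℝ)) T
        - m.lam * ∫ s in (0 : ℝ)..T, Real.exp (-m.rho * s.toNNReal)
            * m.jumpSize v (Function.leftLim K s.toNNReal, P s.toNNReal)) := by
  have hT' : (0 : ℝ) ≤ T := T.2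
  have hK0 : K 0 = k := by
    have := h.eq_K 0
    simpa [IsCountingPath.jumpIntegral_zero] using this
  have hP0 : P 0 = p := by simpa using h.eq_P 0
  obtain ⟨h1, h2⟩ := h.ito_formula hv m.rho hT
  rw [IsCountingPath.jumpIntegral_zero, hK0, hP0] at h2
  simp only [NNReal.coe_zero, mul_zero, Real.exp_zero, one_mul, sub_zero] at h1 h2
  have hPc : AEMeasurable (fun t : ℝ => P t.toNNReal) (volume.restrict (uIoc (0 : ℝ) T)) := by
    have hc : ContinuousOn (fun t : ℝ => p + ∫ r in (0 : ℝ)..t, g r) (uIcc 0 T) :=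
      continuousOn_const.add
        (intervalIntegral.continuousOn_primitive_interval' (h.integrable_g T) left_mem_uIcc)
    refine ((hc.mono uIoc_subset_uIcc).aemeasurable measurableSet_uIoc).congr ?_
    filter_upwards [ae_restrict_mem measurableSet_uIoc] with t ht
    rw [uIoc_of_le hT'] at ht
    rw [h.eq_P, Real.coe_toNNReal t ht.1.le]
  have hKc : AEMeasurable (fun t : ℝ => K t.toNNReal) (volume.restrict (uIoc (0 : ℝ) T)) :=
    (intervalIntegrable_iff.1 (h.intervalIntegrable_K T)).aestronglyMeasurable.aemeasurable
  have hint : IntervalIntegrable (fun t : ℝ =>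
      Real.exp (-m.rho * t) * m.jumpSize v (K t.toNNReal, P t.toNNReal)) volume 0 T := by
    have hb : IntervalIntegrable (fun t : ℝ => m.jumpSize v (K t.toNNReal, P t.toNNReal))
        volume 0 T := by
      refine (intervalIntegrable_const (c := M)).mono_fun ?_ ?_
      · have := (measurable_indicator_of_continuousOn
          (Params.continuousOn_jumpSize (m := m) hv.continuousOn)).comp_aemeasurable
          (hKc.prodMk hPc)
        refine (this.congr (Eventually.of_forall fun t => ?_)).aestronglyMeasurable
        exact indicator_of_mem (h.mem_stateSpace _) _
      · filter_upwards [ae_restrict_mem measurableSet_uIoc] with t ht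
        rw [uIoc_of_le hT'] at ht
        exact (hM _ (Real.toNNReal_le_iff_le_coe.2 ht.2)).trans (le_abs_self M)
    exact hb.continuousOn_mul (by fun_prop)
  -- Left limits and values of capital differ only at the finitely many jump times. The compensator
  -- built from left limits is thus the jump part of the generator, which uses current values.
  have hcongr : ∫ s in (0 : ℝ)..T, Real.exp (-m.rho * s.toNNReal)
        * m.jumpSize v (Function.leftLim K s.toNNReal, P s.toNNReal) =
      ∫ t in (0 : ℝ)..T, Real.exp (-m.rho * t) * m.jumpSize v (K t.toNNReal, P t.toNNReal) := by
    refine intervalIntegral.integral_congr_ae ?_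
    have hnull : ∀ᵐ t : ℝ, t ∉ (fun s : ℝ≥0 => (s : ℝ)) '' (jumpTimes q ∩ Iic T) :=
      ((h.counting.finite_jumpTimes T).image _).countable.ae_notMem _
    filter_upwards [hnull] with t ht htT
    rw [uIoc_of_le hT'] at htT
    have ht0 : 0 < t.toNNReal := Real.toNNReal_pos.2 htT.1
    have htJ : t.toNNReal ∉ jumpTimes q := fun hJ =>
      ht ⟨t.toNNReal, ⟨hJ, Real.toNNReal_le_iff_le_coe.2 htT.2⟩, Real.coe_toNNReal t htT.1.le⟩
    rw [h.leftLim_K_eq_self ht0 htJ, Real.coe_toNNReal t htT.1.le]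
  refine ⟨h1.add (hint.const_mul _), ?_⟩
  rw [intervalIntegral.integral_add h1 (hint.const_mul _), intervalIntegral.integral_const_mul,
    hcongr, h2]
  ring

end IsStatePath

/-! ### Dynkin's formula and verification -/

section Verification

variable {Ω : Type*} [mΩ : MeasurableSpace Ω] {μ : Measure Ω}
  {𝓕 : Filtration ℝ≥0 mΩ} {m : Params} {q : ℝ≥0 → Ω → ℕ} {k p : ℝ} {v : ℝ × ℝ → ℝ}
  {C θ K P : ℝ≥0 → Ω → ℝ}

theorem IsAdmissible.ae_isStatePath (hq : IsPoissonProcess μ 𝓕 m.lam.toNNReal q)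
    (h : IsAdmissible m μ 𝓕 q k p C θ K P) :
    ∀ᵐ ω ∂μ, IsStatePath m (fun t => q t ω) k p
      (fun s => m.driftK (K s.toNNReal ω) (C s.toNNReal ω) (θ s.toNNReal ω))
      (fun s => m.driftP (K s.toNNReal ω) (P s.toNNReal ω) (θ s.toNNReal ω))
      (fun t => K t ω) (fun t => P t ω) := by
  filter_upwards [hq.ae_isCountingPath, h.isState.cadlag, h.isState.mem_stateSpace,
    h.isState.integrable, h.isState.eq_K, h.isState.eq_P] with ω h1 h2 h3 h4 h5 h6
  exact ⟨h1, h2.1, h3, fun t => (h4 t).1, fun t => (h4 t).2, h5, h6⟩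

/-- On a finite horizon the state stays in a deterministic bounded set. -/
theorem IsAdmissible.ae_state_le (hq : IsPoissonProcess μ 𝓕 m.lam.toNNReal q)
    (hkp : (k, p) ∈ stateSpace) (h : IsAdmissible m μ 𝓕 q k p C θ K P) (T : ℝ≥0) :
    ∃ B₁ B₂ : ℝ, ∀ᵐ ω ∂μ, ∀ t ≤ T, K t ω ≤ B₁ ∧ P t ω ≤ B₂ := by
  have hk : 0 < k := hkp.1
  refine ⟨k * Real.exp (m.A * T), p + T * (m.phi * (m.A * (k * Real.exp (m.A * T)))), ?_⟩
  filter_upwards [h.ae_isStatePath hq, h.mem_actions] with ω hω hact t ht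
  have ht' : (t : ℝ) ≤ T := NNReal.coe_le_coe.2 ht
  have hA := m.A_pos
  have hphi := m.phi_pos
  have hf : ∀ᵐ s ∂(volume.restrict (Ioi (0 : ℝ))),
      m.driftK (K s.toNNReal ω) (C s.toNNReal ω) (θ s.toNNReal ω) ≤ m.A * K s.toNNReal ω := by
    filter_upwards [hact] with s hs
    have h1 : 0 < m.A * K s.toNNReal ω := mul_pos hA (hω.mem_stateSpace _).1
    have h2 : 0 ≤ θ s.toNNReal ω * (m.A * K s.toNNReal ω) := mul_nonneg hs.2.1 h1.le
    have h3 : 0 ≤ C s.toNNReal ω := hs.1.1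
    unfold Params.driftK
    linarith
  have hg : ∀ᵐ s ∂(volume.restrict (Ioi (0 : ℝ))),
      m.driftP (K s.toNNReal ω) (P s.toNNReal ω) (θ s.toNNReal ω)
        ≤ m.phi * (m.A * K s.toNNReal ω) := by
    filter_upwards [hact] with s hs
    have h1 : 0 < m.A * K s.toNNReal ω := mul_pos hA (hω.mem_stateSpace _).1
    have h2 : 0 ≤ m.sigma * θ s.toNNReal ω * (m.A * K s.toNNReal ω) :=
      mul_nonneg (mul_nonneg m.sigma_pos.le hs.2.1) h1.le
    have h3 : 0 ≤ m.alpha * P s.toNNReal ω :=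
      mul_nonneg m.alpha_nonneg (hω.mem_stateSpace _).2.le
    unfold Params.driftP
    linarith
  constructor
  · refine (hω.K_le hk hf t).trans ?_
    gcongr
  · refine (hω.P_le hk hf hg t).trans ?_
    gcongr

/-- Discounted running utility accumulated up to time `T`. -/
noncomputable def runningGain (m : Params) (C P : ℝ≥0 → Ω → ℝ) (T : ℝ≥0) (ω : Ω) : ℝ :=
  ∫ t in Ioc (0 : ℝ) T, Real.exp (-m.rho * t) * m.utility (C t.toNNReal ω) (P t.toNNReal ω)

theorem IsAdmissible.integrable_runningGain (h : IsAdmissible m μ 𝓕 q k p C θ K P) (T : ℝ≥0) :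
    Integrable (runningGain m C P T) μ := by
  have h1 := (h.integrable_utility.indicator
    (measurableSet_le measurable_snd measurable_const :
      MeasurableSet {x : Ω × ℝ | x.2 ≤ T})).integral_prod_left
  refine h1.congr (Eventually.of_forall fun ω => ?_)
  have heq : ∀ t : ℝ, ({x : Ω × ℝ | x.2 ≤ T}.indicator (fun x : Ω × ℝ =>
      Real.exp (-m.rho * x.2) * m.utility (C x.2.toNNReal x.1) (P x.2.toNNReal x.1))) (ω, t) =
      (Iic (T : ℝ)).indicator (fun t : ℝ =>
        Real.exp (-m.rho * t) * m.utility (C t.toNNReal ω) (P t.toNNReal ω)) t := fun t => rfl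
  simp only [heq]
  rw [setIntegral_indicator measurableSet_Iic, Ioi_inter_Iic, runningGain]

variable [IsProbabilityMeasure μ]

theorem IsAdmissible.tendsto_integral_runningGain (h : IsAdmissible m μ 𝓕 q k p C θ K P) :
    Tendsto (fun T : ℝ≥0 => ∫ ω, runningGain m C P T ω ∂μ) atTop (𝓝 (gain m μ C P)) := by
  refine tendsto_integral_filter_of_dominated_convergence
    (fun ω => ∫ t in Ioi (0 : ℝ),
      ‖Real.exp (-m.rho * t) * m.utility (C t.toNNReal ω) (P t.toNNReal ω)‖)
    (Eventually.of_forall fun T => (h.integrable_runningGain T).aestronglyMeasurable)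
    (Eventually.of_forall fun T => ?_) h.integrable_utility.norm.integral_prod_left ?_
  · filter_upwards [h.integrable_utility.prod_right_ae] with ω hω
    refine (norm_integral_le_integral_norm _).trans ?_
    exact setIntegral_mono_set hω.norm (Eventually.of_forall fun _ => norm_nonneg _)
      Ioc_subset_Ioi_self.eventuallyLE
  · filter_upwards [h.integrable_utility.prod_right_ae] with ω hω
    refine (intervalIntegral_tendsto_integral_Ioi 0 hω
      (NNReal.tendsto_coe_atTop.2 tendsto_id)).congr fun T => ?_
    exact intervalIntegral.integral_of_le T.2

/-- Needed to split the expectation of terminal value plus running gain, since the integral of a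
nonintegrable function is zero by convention. -/
theorem IsAdmissible.integrable_value (hq : IsPoissonProcess μ 𝓕 m.lam.toNNReal q)
    (hv : ContinuousOn v stateSpace) (hgrowth : PolynomialGrowth v) (hkp : (k, p) ∈ stateSpace)
    (h : IsAdmissible m μ 𝓕 q k p C θ K P) (T : ℝ≥0) :
    Integrable (fun ω => Real.exp (-m.rho * T) * v (K T ω, P T ω)) μ := by
  refine Integrable.const_mul ?_ _
  obtain ⟨B₁, B₂, hB⟩ := h.ae_state_le hq hkp T
  obtain ⟨M, hM⟩ := hgrowth.exists_bound B₁ B₂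
  refine Integrable.of_bound ?_ M ?_
  · have hKP : Measurable fun ω => (K T ω, P T ω) :=
      ((h.isState.adapted_K T).mono (𝓕.le T) le_rfl).prodMk
        ((h.isState.adapted_P T).mono (𝓕.le T) le_rfl)
    refine ((measurable_indicator_of_continuousOn hv).comp hKP).aestronglyMeasurable.congr ?_
    filter_upwards [h.isState.mem_stateSpace] with ω hω
    exact indicator_of_mem (hω T) _
  · filter_upwards [hB, h.isState.mem_stateSpace] with ω h1 h2
    exact hM _ (h2 T) (h1 T le_rfl).1 (h1 T le_rfl).2

/-- The drift of the discounted value process plus the discounted running utility. -/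
noncomputable def hjbDefect (m : Params) (v : ℝ × ℝ → ℝ) (C θ K P : ℝ≥0 → Ω → ℝ) (ω : Ω)
    (t : ℝ) : ℝ :=
  Real.exp (-m.rho * t) * (m.utility (C t.toNNReal ω) (P t.toNNReal ω)
    + m.generator v (C t.toNNReal ω) (θ t.toNNReal ω) (K t.toNNReal ω) (P t.toNNReal ω)
    - m.rho * v (K t.toNNReal ω, P t.toNNReal ω))

/-- Dynkin's formula: up to a mean zero term, the discounted value plus the running utility
equals the initial value plus the accumulated HJB defect. -/
theorem IsAdmissible.dynkin (hq : IsPoissonProcess μ 𝓕 m.lam.toNNReal q)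
    (hv : ContDiffOn ℝ 2 v stateSpace) (hgrowth : PolynomialGrowth v) (hkp : (k, p) ∈ stateSpace)
    (h : IsAdmissible m μ 𝓕 q k p C θ K P) {T : ℝ≥0} (hT : 0 < T) :
    ∃ D : Ω → ℝ, Integrable D μ ∧ ∫ ω, D ω ∂μ = 0 ∧ ∀ᵐ ω ∂μ,
      Real.exp (-m.rho * T) * v (K T ω, P T ω) + runningGain m C P T ω =
        v (k, p) + D ω + ∫ t in Ioc (0 : ℝ) T, hjbDefect m v C θ K P ω t := by
  have hT' : (0 : ℝ) ≤ T := T.2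
  obtain ⟨B₁, B₂, hB⟩ := h.ae_state_le hq hkp T
  obtain ⟨M, hM⟩ := hgrowth.exists_bound B₁ B₂
  have hjump : ∀ᵐ ω ∂μ, ∀ t ≤ T, |m.jumpSize v (K t ω, P t ω)| ≤ 2 * M := by
    filter_upwards [hB, h.isState.mem_stateSpace] with ω h1 h2 t ht
    exact Params.abs_jumpSize_le hM (h2 t) (h1 t ht).1 (h1 t ht).2
  have hlam : (m.lam.toNNReal : ℝ) = m.lam := Real.coe_toNNReal _ m.lam_pos.le
  have hcont := hv.continuousOn
  -- The integrand is cut off outside the state space so that it is adapted for every `ω`; almost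
  -- surely the cutoff is inactive and its left limits are the terms in Itô's formula.
  have hcomp := hq.integral_compensated_jumpIntegral (T := T) (M := 2 * M)
    (h := fun t ω => Real.exp (-m.rho * t) * stateSpace.indicator (m.jumpSize v) (K t ω, P t ω))
    (l := fun s ω => Real.exp (-m.rho * s)
      * m.jumpSize v (Function.leftLim (fun t => K t ω) s, P s ω)) ?_ hT ?_ ?_
  · refine ⟨_, hcomp.1, hcomp.2, ?_⟩
    filter_upwards [h.ae_isStatePath hq, hjump, h.integrable_utility.prod_right_ae]
      with ω hω hJ hU
    obtain ⟨h1, h2⟩ := hω.ito_formula_compensated hv hT hJ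
    have hU' : IntegrableOn (fun t : ℝ => Real.exp (-m.rho * t)
        * m.utility (C t.toNNReal ω) (P t.toNNReal ω)) (Ioc 0 T) :=
      hU.mono_measure (Measure.restrict_mono Ioc_subset_Ioi_self le_rfl)
    have h3 : ∫ t in Ioc (0 : ℝ) T, hjbDefect m v C θ K P ω t = runningGain m C P T ω
        + ∫ t in (0 : ℝ)..T, (chainIntegrand m.rho v (fun t => K t.toNNReal ω)
            (fun t => P t.toNNReal ω)
            (fun s => m.driftK (K s.toNNReal ω) (C s.toNNReal ω) (θ s.toNNReal ω))
            (fun s => m.driftP (K s.toNNReal ω) (P s.toNNReal ω) (θ s.toNNReal ω)) t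
          + m.lam * (Real.exp (-m.rho * t) * m.jumpSize v (K t.toNNReal ω, P t.toNNReal ω))) := by
      rw [intervalIntegral.integral_of_le hT', runningGain, ← integral_add hU' h1.1]
      congr 1
      funext t
      simp only [hjbDefect, chainIntegrand, Params.jumpSize, Params.generator]
      ring
    rw [h3, hlam]
    linarith
  · intro t
    have hKP : Measurable[𝓕 t] fun ω => (K t ω, P t ω) :=
      (h.isState.adapted_K t).prodMk (h.isState.adapted_P t)
    exact ((measurable_indicator_of_continuousOn
      (Params.continuousOn_jumpSize hcont)).comp hKP).const_mul _
  · filter_upwards [hjump, h.isState.mem_stateSpace] with ω h1 h2 t ht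
    rw [indicator_of_mem (h2 t), abs_mul, abs_of_pos (Real.exp_pos _)]
    have : Real.exp (-m.rho * t) ≤ 1 := Real.exp_le_one_iff.2 (by
      rw [neg_mul]
      exact neg_nonpos.2 (mul_nonneg m.rho_pos.le t.2))
    exact (mul_le_of_le_one_left (abs_nonneg _) this).trans (h1 t ht)
  · filter_upwards [h.ae_isStatePath hq] with ω hω s hs
    refine (hω.tendsto_jumpSize hcont hs.1).congr fun t => ?_
    rw [indicator_of_mem (hω.mem_stateSpace t)]

theorem IsAdmissible.tendsto_value_add_runningGain (hTV : Transversality m μ 𝓕 q k p v)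
    (hq : IsPoissonProcess μ 𝓕 m.lam.toNNReal q)
    (hv : ContinuousOn v stateSpace) (hgrowth : PolynomialGrowth v) (hkp : (k, p) ∈ stateSpace)
    (h : IsAdmissible m μ 𝓕 q k p C θ K P) :
    Tendsto (fun T : ℝ≥0 => ∫ ω, (Real.exp (-m.rho * T) * v (K T ω, P T ω)
      + runningGain m C P T ω) ∂μ) atTop (𝓝 (gain m μ C P)) := by
  have h1 := (hTV C θ K P h).add h.tendsto_integral_runningGain
  rw [zero_add] at h1
  refine h1.congr fun T => ?_
  rw [integral_add (h.integrable_value hq hv hgrowth hkp T) (h.integrable_runningGain T)]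

/-- Every admissible control gains at most `v (k, p)`. -/
theorem IsAdmissible.gain_le (hTV : Transversality m μ 𝓕 q k p v)
    (hq : IsPoissonProcess μ 𝓕 m.lam.toNNReal q)
    (hv : ContDiffOn ℝ 2 v stateSpace) (hgrowth : PolynomialGrowth v)
    (hHJB : m.SolvesHJB v) (hkp : (k, p) ∈ stateSpace)
    (h : IsAdmissible m μ 𝓕 q k p C θ K P) : gain m μ C P ≤ v (k, p) := by
  refine le_of_tendsto (h.tendsto_value_add_runningGain hTV hq hv.continuousOn hgrowth hkp) ?_
  filter_upwards [eventually_gt_atTop 0] with T hT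
  obtain ⟨D, hDi, hD0, hD⟩ := h.dynkin hq hv hgrowth hkp hT
  have hmean : ∫ ω, (v (k, p) + D ω) ∂μ = v (k, p) := by
    rw [integral_add (integrable_const _) hDi, hD0]
    simp
  rw [← hmean]
  refine integral_mono_ae ((h.integrable_value hq hv.continuousOn hgrowth hkp T).add
    (h.integrable_runningGain T)) ((integrable_const _).add hDi) ?_
  filter_upwards [hD, h.mem_actions, h.isState.mem_stateSpace] with ω h1 h2 h3
  rw [h1]
  -- The actions are constrained at almost every time only, which suffices; the HJB supremum is used
  -- here just as an upper bound.
  have : ∫ t in Ioc (0 : ℝ) T, hjbDefect m v C θ K P ω t ≤ 0 := by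
    refine integral_nonpos_of_ae ?_
    filter_upwards [ae_restrict_of_ae_restrict_of_subset Ioc_subset_Ioi_self h2] with t ht
    refine mul_nonpos_of_nonneg_of_nonpos (Real.exp_pos _).le (sub_nonpos.2 ?_)
    exact (hHJB _ _ (h3 t.toNNReal)).1 ⟨_, ht.1, _, ht.2, rfl⟩
  linarith

/-- An admissible control that annihilates the HJB defect gains exactly `v (k, p)`. -/
theorem IsAdmissible.gain_eq (hTV : Transversality m μ 𝓕 q k p v)
    (hq : IsPoissonProcess μ 𝓕 m.lam.toNNReal q)
    (hv : ContDiffOn ℝ 2 v stateSpace) (hgrowth : PolynomialGrowth v) (hkp : (k, p) ∈ stateSpace)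
    (h : IsAdmissible m μ 𝓕 q k p C θ K P)
    (hopt : ∀ᵐ ω ∂μ, ∀ t, hjbDefect m v C θ K P ω t = 0) : gain m μ C P = v (k, p) := by
  -- With zero defect the expected value plus running gain equals `v (k, p)` for every `T > 0`,
  -- hence so does its limit.
  refine tendsto_nhds_unique
    (h.tendsto_value_add_runningGain hTV hq hv.continuousOn hgrowth hkp)
    (tendsto_const_nhds.congr' ?_)
  filter_upwards [eventually_gt_atTop 0] with T hT
  obtain ⟨D, hDi, hD0, hD⟩ := h.dynkin hq hv hgrowth hkp hT
  have hmean : ∫ ω, (v (k, p) + D ω) ∂μ = v (k, p) := by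
    rw [integral_add (integrable_const _) hDi, hD0]
    simp
  rw [← hmean]
  refine integral_congr_ae ?_
  filter_upwards [hD, hopt] with ω h1 h2
  rw [h1, funext h2]
  simp

end Verification

end GrowthEnv

theorem mainTheorem4 (m : Params)
    {Ω : Type*} [mΩ : MeasurableSpace Ω] (μ : Measure Ω) [IsProbabilityMeasure μ]
    (𝓕 : Filtration ℝ≥0 mΩ) (h𝓕 : UsualConditions μ 𝓕)
    (q : ℝ≥0 → Ω → ℕ) (hq : IsPoissonProcess μ 𝓕 m.lam.toNNReal q)
    (v : ℝ × ℝ → ℝ) (hv : ContDiffOn ℝ 2 v stateSpace) (hgrowth : PolynomialGrowth v)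
    (hHJB : m.SolvesHJB v)
    (k p : ℝ) (hkp : (k, p) ∈ stateSpace)
    (hTV : Transversality m μ 𝓕 q k p v) :
    -- upper bound
    (∀ C θ K P : ℝ≥0 → Ω → ℝ, IsAdmissible m μ 𝓕 q k p C θ K P → gain m μ C P ≤ v (k, p)) ∧
    -- optimality of maximizing feedbacks
    (∀ Chat thetahat : ℝ × ℝ → ℝ, IsMaximizingFeedback m v Chat thetahat →
      ∀ K P : ℝ≥0 → Ω → ℝ,
        IsAdmissible m μ 𝓕 q k p (fun t ω => Chat (K t ω, P t ω))
          (fun t ω => thetahat (K t ω, P t ω)) K P →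
        v (k, p) = gain m μ (fun t ω => Chat (K t ω, P t ω)) P ∧
        IsLUB (gains m μ 𝓕 q k p) (v (k, p))) := by
  refine ⟨fun C θ K P h => h.gain_le hTV hq hv hgrowth hHJB hkp, ?_⟩
  intro Chat thetahat hmax K P h
  have heq := h.gain_eq hTV hq hv hgrowth hkp (by
    filter_upwards [h.isState.mem_stateSpace] with ω hω t
    -- Least upper bounds are unique, so the value attained by the feedback is `ρ v` and the defect
    -- vanishes.
    have := (hmax.attains _ _ (hω t.toNNReal)).unique (hHJB _ _ (hω t.toNNReal))
    rw [hjbDefect, this, sub_self, mul_zero])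
  refine ⟨heq.symm, ?_, fun b hb => ?_⟩
  · rintro _ ⟨C', θ', K', P', h', rfl⟩
    exact h'.gain_le hTV hq hv hgrowth hHJB hkp
  -- The value is itself one of the gains, so every upper bound dominates it.
  · rw [← heq]
    exact hb ⟨_, _, K, P, h, rfl⟩
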